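/- Theorem (Spectrum of the linear operator). Let $\mathbb H=\{(r,z)\in\mathbb R^2: r>0\}$, let $\mu$ be the measure on $\mathbb H$ with $d\mu=\frac1{16\sqrt\pi}\,r^3e^{-(r^2+z^2)/4}\,dr\,dz$, and let $L^2(\mu)$ be the Hilbert space of $\mathbb K$-valued square integrable functions, where $\mathbb K=\mathbb R$ or $\mathbb K=\mathbb C$. Let $$\mathcal L f=-\partial_r^2f-\partial_z^2 f+\tfrac12\,(r\,\partial_r f+z\,\partial_z f)-\tfrac3r\,\partial_r f ,$$ considered as an unbounded operator in $L^2(\mu)$ whose domain consists of all $f\in L^2(\mu)$ for which $\mathcal Lf$, taken in the sense of distributions on $\mathbb H$, belongs to $L^2(\mu)$; equivalently, $\mathcal Lf=g$ means $f,g\in L^2(\mu)$ and $\int f\,\mathcal L\varphi\,d\mu=\int g\,\varphi\,d\mu$ for all real-valued $\varphi\in C_c^\infty(\mathbb H)$. For $\ell,n\in\mathbb N_0$ let $$L^{(1)}_\ell(x)=\sum_{k=0}^{\ell}(-1)^k\binom{\ell+1}{\ell-k}\frac{x^k}{k!},\qquad H_0=1,\quad H_{n+1}(x)=2xH_n(x)-H_n'(x)$$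 be the associated Laguerre polynomials and the (physicists') Hermite polynomials, and put $\lambda_{\ell,n}=\ell+\frac n2$. Then: 1. $\mathcal L$ is self-adjoint in $L^2(\mu)$. 2. The spectrum of $\mathcal L$ is purely discrete, i.e. it consists of eigenvalues of finite multiplicity and has no accumulation point in $\mathbb K$. Both the spectrum and the set of eigenvalues are equal to $\{\lambda_{\ell,n}:\ell,n\in\mathbb N_0\}$. 3. The polynomials $L_\ell^{(1)}(r^2/4)\,H_n(z/2)$ satisfy $\mathcal L f=\lambda_{\ell,n}f$ pointwise in $\mathbb H$. There are normalization constants $c_{\ell,n}>0$ such that the functions $$\psi_{\ell,n}(r,z)=c_{\ell,n}\,L_\ell^{(1)}\!\left(\tfrac{r^2}{4}\right)H_n\!\left(\tfrac z2\right),\qquad \ell,n\in\mathbb N_0,$$ form an orthonormal basis of $L^2(\mu)$, each $\psi_{\ell,n}$ belongs to the domain of $\mathcal L$ with $\mathcal L\psi_{\ell,n}=\lambda_{\ell,n}\psi_{\ell,n}$, and, for every $\zeta\in\mathbb K$, the space of all $f$ in the domain of $\mathcal L$ with $\mathcal Lf=\zeta f$ is the linear span of those $\psi_{\ell,n}$ with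 $\lambda_{\ell,n}=\zeta$. 4. For every $m\in\mathbb N_0$, the eigenvalues $\frac{2m}2$ and $\frac{2m+1}2$ both have multiplicity $m+1$. -/

import Mathlib

open MeasureTheory Set Filter Topology
open scoped ContDiff

noncomputable section

namespace VortexSpectrum

/-! ### Unbounded operators: eigenspaces, spectrum, discreteness -/

section Unbounded

variable {𝕜 E : Type*} [RCLike 𝕜] [NormedAddCommGroup E] [InnerProductSpace 𝕜 E]

/-- The eigenspace `{x ∈ D(A) : A x = ζ x}` of a partially defined operator. -/
def eigenspace (A : E →ₗ.[𝕜] E) (ζ : 𝕜) : Submodule 𝕜 E :=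
  (LinearMap.ker (A.toFun - ζ • A.domain.subtype)).map A.domain.subtype

/-- The resolvent set: all `ζ` for which `A - ζ : D(A) → E` is a bijection
with bounded (everywhere defined) inverse `R`. -/
def resolventSet (A : E →ₗ.[𝕜] E) : Set 𝕜 :=
  {ζ | ∃ R : E →L[𝕜] E, (∀ x : A.domain, R (A x - ζ • (x : E)) = x) ∧
    ∀ y : E, ∃ x : A.domain, R y = x ∧ A x - ζ • (x : E) = y}

/-- The spectrum of a partially defined operator. -/
def spectrum (A : E →ₗ.[𝕜] E) : Set 𝕜 := (resolventSet A)ᶜ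

/-- The spectrum is purely discrete: it consists of eigenvalues of finite multiplicity and has no
(finite) accumulation point. -/
def HasPurelyDiscreteSpectrum (A : E →ₗ.[𝕜] E) : Prop :=
  (∀ ζ ∈ spectrum A, eigenspace A ζ ≠ ⊥ ∧ FiniteDimensional 𝕜 (eigenspace A ζ)) ∧
    ∀ ζ : 𝕜, ¬ AccPt ζ (𝓟 (spectrum A))

end Unbounded

/-! ### The weighted half-plane -/

/-- The open half-plane `ℍ = {(r, z) : r > 0}`. -/
def halfPlane : Set (ℝ × ℝ) := {p | 0 < p.1}

/-- The density `r³ exp(-(r² + z²)/4) / (16 √π)`. -/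
def density (p : ℝ × ℝ) : ℝ :=
  1 / (16 * √Real.pi) * p.1 ^ 3 * Real.exp (-(p.1 ^ 2 + p.2 ^ 2) / 4)

/-- The measure `μ` on the half-plane, extended by zero to the plane. -/
def mu : Measure (ℝ × ℝ) :=
  (volume.restrict halfPlane).withDensity fun p => ENNReal.ofReal (density p)

/-! ### The differential expression -/

/-- The partial derivative `∂_r`. -/
def dr (f : ℝ × ℝ → ℝ) (p : ℝ × ℝ) : ℝ := fderiv ℝ f p (1, 0)

/-- The partial derivative `∂_z`. -/
def dz (f : ℝ × ℝ → ℝ) (p : ℝ × ℝ) : ℝ := fderiv ℝ f p (0, 1)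

/-- The differential expression `-Δ f + ½ (r, z) · ∇ f - (3/r) ∂_r f` for `f` of class `C²`. -/
def diffExpr (f : ℝ × ℝ → ℝ) (p : ℝ × ℝ) : ℝ :=
  -(dr (dr f) p + dz (dz f) p) + 1 / 2 * (p.1 * dr f p + p.2 * dz f p) - 3 / p.1 * dr f p

/-- Test functions: smooth with compact support contained in the open half-plane. -/
def IsTest (φ : ℝ × ℝ → ℝ) : Prop :=
  ContDiff ℝ ∞ φ ∧ HasCompactSupport φ ∧ tsupport φ ⊆ halfPlane

/-! ### Helper facts -/

theorem isOpen_halfPlane : IsOpen halfPlane := isOpen_lt continuous_const continuous_fst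

theorem continuous_density : Continuous density := by
  unfold density; fun_prop

instance : IsLocallyFiniteMeasure mu := IsLocallyFiniteMeasure.withDensity_ofReal continuous_density

theorem ae_mem_halfPlane : ∀ᵐ p ∂mu, p ∈ halfPlane :=
  (withDensity_absolutelyContinuous _ _).ae_le (ae_restrict_mem isOpen_halfPlane.measurableSet)

theorem integrable_smul_coeFn {𝕜 : Type*} [RCLike 𝕜] {φ : ℝ × ℝ → ℝ} (hφ : Continuous φ)
    (hc : HasCompactSupport φ) (f : Lp 𝕜 2 mu) : Integrable (fun p => φ p • f p) mu := by
  have h : LocallyIntegrable (f : ℝ × ℝ → 𝕜) mu := (Lp.memLp f).locallyIntegrable (by norm_num)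
  exact h.integrable_smul_left_of_hasCompactSupport hφ hc

theorem contDiff_dr {f : ℝ × ℝ → ℝ} (hf : ContDiff ℝ ∞ f) : ContDiff ℝ ∞ (dr f) :=
  (hf.fderiv_right (m := ∞) (by simp)).clm_apply contDiff_const

theorem contDiff_dz {f : ℝ × ℝ → ℝ} (hf : ContDiff ℝ ∞ f) : ContDiff ℝ ∞ (dz f) :=
  (hf.fderiv_right (m := ∞) (by simp)).clm_apply contDiff_const

theorem tsupport_dr_subset (f : ℝ × ℝ → ℝ) : tsupport (dr f) ⊆ tsupport f :=
  tsupport_fderiv_apply_subset ℝ (1, 0)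

theorem tsupport_dz_subset (f : ℝ × ℝ → ℝ) : tsupport (dz f) ⊆ tsupport f :=
  tsupport_fderiv_apply_subset ℝ (0, 1)

theorem tsupport_diffExpr_subset (f : ℝ × ℝ → ℝ) : tsupport (diffExpr f) ⊆ tsupport f := by
  refine closure_minimal (fun p hp => ?_) (isClosed_tsupport f)
  by_contra h
  have h1 : dr f p = 0 := image_eq_zero_of_notMem_tsupport fun h' => h (tsupport_dr_subset f h')
  have h2 : dz f p = 0 := image_eq_zero_of_notMem_tsupport fun h' => h (tsupport_dz_subset f h')
  have h3 : dr (dr f) p = 0 := image_eq_zero_of_notMem_tsupport fun h' =>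
    h (tsupport_dr_subset f (tsupport_dr_subset _ h'))
  have h4 : dz (dz f) p = 0 := image_eq_zero_of_notMem_tsupport fun h' =>
    h (tsupport_dz_subset f (tsupport_dz_subset _ h'))
  exact hp (by simp [diffExpr, h1, h2, h3, h4])

theorem IsTest.hasCompactSupport_diffExpr {φ : ℝ × ℝ → ℝ} (hφ : IsTest φ) :
    HasCompactSupport (diffExpr φ) :=
  hφ.2.1.of_isClosed_subset (isClosed_tsupport _) (tsupport_diffExpr_subset φ)

theorem IsTest.continuous_diffExpr {φ : ℝ × ℝ → ℝ} (hφ : IsTest φ) :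
    Continuous (diffExpr φ) := by
  refine continuous_of_tsupport fun p hp => ?_
  have hp0 : p.1 ≠ 0 := ne_of_gt (hφ.2.2 (tsupport_diffExpr_subset φ hp))
  have h1 := (contDiff_dr hφ.1).continuous.continuousAt (x := p)
  have h2 := (contDiff_dz hφ.1).continuous.continuousAt (x := p)
  have h3 := (contDiff_dr (contDiff_dr hφ.1)).continuous.continuousAt (x := p)
  have h4 := (contDiff_dz (contDiff_dz hφ.1)).continuous.continuousAt (x := p)
  unfold diffExpr
  fun_prop (disch := assumption)

/-! ### The operator -/

/-- The graph of the operator: all pairs `(f, g)` in `L²(μ) × L²(μ)` with `𝓛 f = g` in the sense of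
distributions on the half-plane. The density of `μ` is smooth and positive there and the expression
is formally symmetric with respect to `μ`, so this reads `∫ (𝓛 φ) f dμ = ∫ φ g dμ` for all test
functions `φ`. -/
def opGraph (𝕜 : Type*) [RCLike 𝕜] : Submodule 𝕜 (Lp 𝕜 2 mu × Lp 𝕜 2 mu) where
  carrier := {x | ∀ φ : ℝ × ℝ → ℝ, IsTest φ →
    ∫ p, diffExpr φ p • x.1 p ∂mu = ∫ p, φ p • x.2 p ∂mu}
  zero_mem' := fun φ _ => by
    have h := Lp.coeFn_zero 𝕜 2 mu
    have e : ∀ u : ℝ × ℝ → ℝ, ∫ p, u p • (0 : Lp 𝕜 2 mu) p ∂mu = 0 := fun u => by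
      rw [integral_congr_ae (g := fun _ => (0 : 𝕜)) (by filter_upwards [h] with p hp; rw [hp]; simp)]
      simp
    exact (e _).trans (e _).symm
  add_mem' := fun {x y} hx hy φ hφ => by
    have e : ∀ u : ℝ × ℝ → ℝ, Continuous u → HasCompactSupport u → ∀ f g : Lp 𝕜 2 mu,
        ∫ p, u p • (f + g) p ∂mu = ∫ p, u p • f p ∂mu + ∫ p, u p • g p ∂mu := fun u hu hc f g => by
      rw [← integral_add (integrable_smul_coeFn hu hc f) (integrable_smul_coeFn hu hc g)]
      refine integral_congr_ae ?_
      filter_upwards [Lp.coeFn_add f g] with p hp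
      rw [hp, Pi.add_apply, smul_add]
    change ∫ p, diffExpr φ p • (x.1 + y.1) p ∂mu = ∫ p, φ p • (x.2 + y.2) p ∂mu
    rw [e _ hφ.continuous_diffExpr hφ.hasCompactSupport_diffExpr, e _ hφ.1.continuous hφ.2.1,
      hx φ hφ, hy φ hφ]
  smul_mem' := fun c x hx φ hφ => by
    have e : ∀ (u : ℝ × ℝ → ℝ) (f : Lp 𝕜 2 mu),
        ∫ p, u p • (c • f) p ∂mu = c * ∫ p, u p • f p ∂mu := fun u f => by
      rw [← integral_const_mul]
      refine integral_congr_ae ?_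
      filter_upwards [Lp.coeFn_smul c f] with p hp
      simp [hp]
    change ∫ p, diffExpr φ p • (c • x.1) p ∂mu = ∫ p, φ p • (c • x.2) p ∂mu
    rw [e, e, hx φ hφ]

/-- `𝓛 f` is uniquely determined by `f`. -/
theorem opGraph_snd_eq_zero (𝕜 : Type*) [RCLike 𝕜] (x : Lp 𝕜 2 mu × Lp 𝕜 2 mu)
    (hx : x ∈ opGraph 𝕜) (h0 : x.1 = 0) : x.2 = 0 := by
  have hl : LocallyIntegrable (x.2 : ℝ × ℝ → 𝕜) mu :=
    (Lp.memLp x.2).locallyIntegrable (by norm_num)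
  have h := isOpen_halfPlane.ae_eq_zero_of_integral_contDiff_smul_eq_zero
    (hl.locallyIntegrableOn halfPlane) (fun φ h1 h2 h3 => by
      rw [← hx φ ⟨h1, h2, h3⟩, h0, integral_congr_ae (g := fun _ => (0 : 𝕜))
        (by filter_upwards [Lp.coeFn_zero 𝕜 2 mu] with p hp; rw [hp]; simp)]
      simp)
  refine Lp.ext ?_
  filter_upwards [h, ae_mem_halfPlane, Lp.coeFn_zero 𝕜 2 mu] with p hp hp' h0
  rw [hp hp', h0]; rfl

/-- The operator `𝓛` in `L²(μ)`, with domain the set of all `f ∈ L²(μ)` for which the distribution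
`𝓛 f` lies in `L²(μ)`. -/
def op (𝕜 : Type*) [RCLike 𝕜] : Lp 𝕜 2 mu →ₗ.[𝕜] Lp 𝕜 2 mu := (opGraph 𝕜).toLinearPMap

theorem op_graph (𝕜 : Type*) [RCLike 𝕜] : (op 𝕜).graph = opGraph 𝕜 :=
  (opGraph 𝕜).toLinearPMap_graph_eq (opGraph_snd_eq_zero 𝕜)

/-! ### The polynomials -/

/-- The associated Laguerre polynomial
`L_ℓ^{(α)}(x) = ∑_{k=0}^ℓ (-1)^k binom(ℓ+α, ℓ-k) x^k / k!` for integer `α ≥ 0`. -/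
def laguerre (α ℓ : ℕ) : Polynomial ℝ :=
  ∑ k ∈ Finset.range (ℓ + 1),
    Polynomial.C ((-1) ^ k * ((ℓ + α).choose (ℓ - k) : ℝ) / (k.factorial : ℝ)) * Polynomial.X ^ k

/-- The (physicists') Hermite polynomials: `H_0 = 1` and `H_{n+1}(x) = 2 x H_n(x) - H_n'(x)`,
that is, `H_n(x) = (-1)^n exp(x²) (d/dx)^n exp(-x²)`. -/
def hermite : ℕ → Polynomial ℝ
  | 0 => 1
  | n + 1 => 2 * Polynomial.X * hermite n - Polynomial.derivative (hermite n)

/-- The polynomial `L_ℓ^{(1)}(r²/4) H_n(z/2)`. -/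
def eigenfun (ℓ n : ℕ) (p : ℝ × ℝ) : ℝ :=
  (laguerre 1 ℓ).eval (p.1 ^ 2 / 4) * (hermite n).eval (p.2 / 2)

/-- `λ_{ℓ,n} = ℓ + n/2`. -/
def eigenval (ℓ n : ℕ) : ℝ := ℓ + n / 2

end VortexSpectrum

end

/-! On the half-plane the expression is `-ρ⁻¹ div(ρ ∇f)` with `ρ` the density of `mu`, hence
formally symmetric. In the variables `x = r²/4` and `y = z/2` it separates into the Laguerre
equation with parameter 1 and the Hermite equation, so the products `eigenfun ℓ n` solve the
eigenvalue equation pointwise.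

Everything else follows once `op` is shown to be the maximal operator that is diagonal in a Hilbert
basis of eigenfunctions (`isDiagonal_op`). For such an operator with real eigenvalues, finitely many
in each bounded set, self-adjointness is Parseval's identity, the resolvent is a bounded multiplier,
and multiplicities are counts of indices.

Diagonality has two halves. If the coefficients of `g` are `λ_i` times those of `f`, Parseval gives
the weak equation, because each eigenfunction satisfies it. Conversely, the weak equation must be
tested with eigenfunctions, which are not compactly supported in the open half-plane
(`inner_eigenfun_of_mem_opGraph`). They are cut off at `r ~ 1/K` and at `r² + z² ~ K`. The weight
`r³` makes the axis behave like a set of codimension 4, the borderline case: the error has size `K²`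
on `r ≤ 2/K`, and its squared norm `K⁴ ∫_0^{2/K} r³ dr` stays bounded without tending to zero.
Boundedness suffices, since the error vanishes eventually at every point of the half-plane and so
converges weakly to zero.

Completeness (`ae_eq_zero_of_integral_polyFun_eq_zero`) is a moment argument: if all moments of `f`
in `r²/4` and `z` vanish, so does the Fourier transform of `f dμ` in these variables, and the
variables determine the point of the half-plane. -/

namespace VortexSpectrum

/-! ### Operators diagonal in a Hilbert basis -/

section Diagonal

variable {𝕜 E ι : Type*} [RCLike 𝕜] [NormedAddCommGroup E] [InnerProductSpace 𝕜 E]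

/-- `A` is the maximal operator which is diagonal in the Hilbert basis `ψ` with eigenvalues `lam`. -/
def IsDiagonal (A : E →ₗ.[𝕜] E) (ψ : HilbertBasis ι 𝕜 E) (lam : ι → ℝ) : Prop :=
  ∀ x y : E, (x, y) ∈ A.graph ↔ ∀ i, inner 𝕜 (ψ i) y = (lam i : 𝕜) * inner 𝕜 (ψ i) x

theorem _root_.HilbertBasis.ext_inner (ψ : HilbertBasis ι 𝕜 E) {x y : E}
    (h : ∀ i, inner 𝕜 (ψ i) x = inner 𝕜 (ψ i) y) : x = y := by
  apply ψ.repr.injective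
  ext i
  simp [h i, HilbertBasis.repr_apply_apply]

theorem mem_eigenspace_iff (A : E →ₗ.[𝕜] E) (ζ : 𝕜) (x : E) :
    x ∈ eigenspace A ζ ↔ (x, ζ • x) ∈ A.graph := by
  simp only [eigenspace, Submodule.mem_map, LinearMap.mem_ker, LinearMap.sub_apply,
    LinearMap.smul_apply, sub_eq_zero, LinearPMap.mem_graph_iff]
  constructor
  · rintro ⟨y, hy, rfl⟩
    exact ⟨y, rfl, hy⟩
  · rintro ⟨y, hy, hy'⟩
    refine ⟨y, ?_, hy⟩
    change A y = ζ • (y : E)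
    rw [hy', hy]

variable {A : E →ₗ.[𝕜] E} {ψ : HilbertBasis ι 𝕜 E} {lam : ι → ℝ}

theorem IsDiagonal.mem_eigenspace (hA : IsDiagonal A ψ lam) (ζ : 𝕜) (x : E) :
    x ∈ eigenspace A ζ ↔ ∀ i, (lam i : 𝕜) ≠ ζ → inner 𝕜 (ψ i) x = 0 := by
  rw [mem_eigenspace_iff, hA]
  refine forall_congr' fun i => ?_
  rw [inner_smul_right, ← sub_eq_zero, ← sub_mul, mul_eq_zero, sub_eq_zero, eq_comm (a := ζ)]
  tauto

theorem _root_.HilbertBasis.inner_eq_ite [DecidableEq ι] (ψ : HilbertBasis ι 𝕜 E) (i j : ι) :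
    inner 𝕜 (ψ i) (ψ j) = if i = j then (1 : 𝕜) else 0 :=
  orthonormal_iff_ite.mp ψ.orthonormal i j

theorem IsDiagonal.basis_mem_eigenspace (hA : IsDiagonal A ψ lam) (i : ι) :
    ψ i ∈ eigenspace A (lam i : 𝕜) := by
  classical
  rw [hA.mem_eigenspace]
  intro j hj
  rw [ψ.inner_eq_ite, if_neg]
  rintro rfl
  exact hj rfl

theorem IsDiagonal.basis_mem_domain (hA : IsDiagonal A ψ lam) (i : ι) : ψ i ∈ A.domain :=
  LinearPMap.mem_domain_of_mem_graph
    ((mem_eigenspace_iff A (lam i : 𝕜) (ψ i)).mp (hA.basis_mem_eigenspace i))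

theorem IsDiagonal.dense_domain (hA : IsDiagonal A ψ lam) : Dense (A.domain : Set E) := by
  refine (Submodule.dense_iff_topologicalClosure_eq_top.mpr ψ.dense_span).mono ?_
  refine SetLike.coe_subset_coe.mpr (Submodule.span_le.mpr ?_)
  rintro _ ⟨i, rfl⟩
  exact hA.basis_mem_domain i

/-- Testing a pair of the adjoint graph with `(ψ i, lam i • ψ i)` gives the diagonal relation,
because `lam i` is real. Conversely, Parseval's identity turns two diagonal relations into the
adjoint relation. Maximality of the domain makes the two graphs equal. -/
theorem IsDiagonal.isSelfAdjoint [CompleteSpace E] (hA : IsDiagonal A ψ lam) :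
    IsSelfAdjoint A := by
  rw [LinearPMap.isSelfAdjoint_def]
  apply LinearPMap.eq_of_eq_graph
  rw [LinearPMap.adjoint_graph_eq_graph_adjoint hA.dense_domain]
  ext ⟨x, y⟩
  rw [Submodule.mem_adjoint_iff, hA]
  constructor
  · intro h i
    have := h _ _ ((mem_eigenspace_iff A (lam i : 𝕜) (ψ i)).mp (hA.basis_mem_eigenspace i))
    rw [sub_eq_zero, inner_smul_left, RCLike.conj_ofReal] at this
    exact this.symm
  · intro h a b hab
    rw [hA] at hab
    rw [sub_eq_zero]
    have h1 := ψ.hasSum_inner_mul_inner b x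
    have h2 := ψ.hasSum_inner_mul_inner a y
    refine h1.unique ?_
    convert h2 using 2 with i
    rw [h i, ← inner_conj_symm b, hab i, ← inner_conj_symm a, map_mul, RCLike.conj_ofReal]
    ring

theorem finite_eigenvalue_fiber (hfin : ∀ R : ℝ, {i | |lam i| ≤ R}.Finite) (ζ : 𝕜) :
    {i | (lam i : 𝕜) = ζ}.Finite := (hfin ‖ζ‖).subset fun i hi => by
  have hi : (lam i : 𝕜) = ζ := hi
  simp [← hi]

/-- Only finitely many indices share the eigenvalue `ζ`, so the expansion of an eigenvector is a
finite sum and the algebraic span needs no closure. -/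
theorem IsDiagonal.eigenspace_eq_span (hA : IsDiagonal A ψ lam)
    (hfin : ∀ R : ℝ, {i | |lam i| ≤ R}.Finite) (ζ : 𝕜) :
    eigenspace A ζ = Submodule.span 𝕜 (ψ '' {i | (lam i : 𝕜) = ζ}) := by
  classical
  apply le_antisymm
  · intro x hx
    rw [hA.mem_eigenspace] at hx
    have hs := finite_eigenvalue_fiber hfin ζ
    have h1 := ψ.hasSum_repr x
    have h2 : HasSum (fun i => ψ.repr x i • ψ i) (∑ i ∈ hs.toFinset, ψ.repr x i • ψ i) := by
      refine hasSum_sum_of_ne_finset_zero fun i hi => ?_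
      rw [ψ.repr_apply_apply, hx i (by simpa using hi), zero_smul]
    rw [h1.unique h2]
    refine Submodule.sum_mem _ fun i hi => Submodule.smul_mem _ _ (Submodule.subset_span ?_)
    exact ⟨i, by simpa using hi, rfl⟩
  · rw [Submodule.span_le]
    rintro _ ⟨i, hi, rfl⟩
    have hi : (lam i : 𝕜) = ζ := hi
    exact hi ▸ hA.basis_mem_eigenspace i

theorem IsDiagonal.finiteDimensional_eigenspace (hA : IsDiagonal A ψ lam)
    (hfin : ∀ R : ℝ, {i | |lam i| ≤ R}.Finite) (ζ : 𝕜) :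
    FiniteDimensional 𝕜 (eigenspace A ζ) := by
  rw [hA.eigenspace_eq_span hfin]
  exact FiniteDimensional.span_of_finite 𝕜 ((finite_eigenvalue_fiber hfin ζ).image _)

theorem IsDiagonal.finrank_eigenspace (hA : IsDiagonal A ψ lam)
    (hfin : ∀ R : ℝ, {i | |lam i| ≤ R}.Finite) (ζ : 𝕜) :
    Module.finrank 𝕜 (eigenspace A ζ) = {i | (lam i : 𝕜) = ζ}.ncard := by
  have := (finite_eigenvalue_fiber hfin ζ).fintype
  rw [hA.eigenspace_eq_span hfin, Set.image_eq_range]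
  refine (finrank_span_eq_card
    (ψ.orthonormal.linearIndependent.comp _ Subtype.val_injective)).trans ?_
  rw [← Nat.card_eq_fintype_card, Nat.card_coe_set_eq]

theorem IsDiagonal.eigenspace_ne_bot_iff (hA : IsDiagonal A ψ lam) (ζ : 𝕜) :
    eigenspace A ζ ≠ ⊥ ↔ ∃ i, (lam i : 𝕜) = ζ := by
  constructor
  · intro h
    by_contra! hne
    refine h ((Submodule.eq_bot_iff _).mpr fun x hx => ψ.ext_inner fun i => ?_)
    rw [(hA.mem_eigenspace ζ x).mp hx i (hne i), inner_zero_right]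
  · rintro ⟨i, rfl⟩ h
    have := hA.basis_mem_eigenspace i
    rw [h, Submodule.mem_bot] at this
    have h1 := ψ.orthonormal.1 i
    rw [this, norm_zero] at h1
    exact zero_ne_one h1

/-- A bounded multiplication operator in the coordinates of a Hilbert basis. -/
theorem _root_.HilbertBasis.exists_diagonal_clm (ψ : HilbertBasis ι 𝕜 E) (m : ι → 𝕜) (C : ℝ)
    (hm : ∀ i, ‖m i‖ ≤ C) :
    ∃ R : E →L[𝕜] E, ∀ x i, inner 𝕜 (ψ i) (R x) = m i * inner 𝕜 (ψ i) x := by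
  have hmem : ∀ x : lp (fun _ : ι => 𝕜) 2, Memℓp (fun i => m i * x i) 2 := fun x => by
    refine memℓp_gen ?_
    have h := (lp.memℓp x).summable (by norm_num)
    -- When `ι` is empty the bound `C` may be negative, hence `max C 0`.
    refine Summable.of_nonneg_of_le (fun i => by positivity) (fun i => ?_)
      (h.mul_left ((max C 0) ^ (2 : ENNReal).toReal))
    rw [norm_mul, ← Real.mul_rpow (le_max_right _ _) (norm_nonneg _)]
    gcongr
    exact (hm i).trans (le_max_left _ _)
  let T : lp (fun _ : ι => 𝕜) 2 →ₗ[𝕜] lp (fun _ : ι => 𝕜) 2 :=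
    { toFun := fun x => ⟨fun i => m i * x i, hmem x⟩
      map_add' := fun x y => by ext i; simp [mul_add]; rfl
      map_smul' := fun c x => by ext i; simp [mul_left_comm] }
  have hT : ∀ x, ‖T x‖ ≤ max C 0 * ‖x‖ := fun x => by
    refine lp.norm_le_of_forall_sum_le (p := 2) (by norm_num) (by positivity) fun s => ?_
    rw [Real.mul_rpow (by positivity) (by positivity)]
    refine le_trans ?_ (mul_le_mul_of_nonneg_left
      (lp.sum_rpow_le_norm_rpow (p := 2) (by norm_num) x s) (by positivity))
    rw [Finset.mul_sum]
    refine Finset.sum_le_sum fun i _ => ?_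
    rw [← Real.mul_rpow (le_max_right _ _) (norm_nonneg _)]
    gcongr
    change ‖m i * x i‖ ≤ _
    rw [norm_mul]
    gcongr
    exact (hm i).trans (le_max_left _ _)
  refine ⟨(ψ.repr.symm.toContinuousLinearEquiv : _ →L[𝕜] E) ∘L (T.mkContinuous _ hT) ∘L
    (ψ.repr.toContinuousLinearEquiv : E →L[𝕜] _), fun x i => ?_⟩
  rw [← ψ.repr_apply_apply, ← ψ.repr_apply_apply]
  simp [T]

/-- An eigenvector obstructs injectivity. Away from the eigenvalues the resolvent is multiplication
of the coefficients by `(lam i - ζ)⁻¹`, and maximality of the domain puts its values into the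
domain. -/
theorem IsDiagonal.mem_resolventSet_iff (hA : IsDiagonal A ψ lam)
    (hfin : ∀ R : ℝ, {i | |lam i| ≤ R}.Finite) (ζ : 𝕜) :
    ζ ∈ resolventSet A ↔ ∀ i, (lam i : 𝕜) ≠ ζ := by
  constructor
  · rintro ⟨R, hR, -⟩ i hi
    have hg := (mem_eigenspace_iff A (lam i : 𝕜) (ψ i)).mp (hA.basis_mem_eigenspace i)
    obtain ⟨y, hy, hy'⟩ := (LinearPMap.mem_graph_iff A).mp hg
    have := hR y
    simp only at hy hy'
    rw [hy', hy, hi, sub_self, map_zero] at this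
    have h1 := ψ.orthonormal.1 i
    rw [← this, norm_zero] at h1
    exact zero_ne_one h1
  · intro h
    have hb : ∃ C : ℝ, ∀ i, ‖((lam i : 𝕜) - ζ)⁻¹‖ ≤ C := by
      -- Outside this finite set `|lam i| > ‖ζ‖ + 1`, so `lam i` has distance at least 1 from `ζ`
      -- and the inverse is bounded by 1.
      have hs := hfin (‖ζ‖ + 1)
      obtain ⟨C, hC⟩ := (hs.image fun i => ‖((lam i : 𝕜) - ζ)⁻¹‖).bddAbove
      refine ⟨max C 1, fun i => ?_⟩
      by_cases hi : |lam i| ≤ ‖ζ‖ + 1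
      · exact (hC ⟨i, hi, rfl⟩).trans (le_max_left _ _)
      · refine le_trans ?_ (le_max_right _ _)
        rw [norm_inv]
        apply inv_le_one_of_one_le₀
        have := norm_sub_norm_le (lam i : 𝕜) ζ
        rw [RCLike.norm_ofReal] at this
        linarith
    obtain ⟨C, hC⟩ := hb
    obtain ⟨R, hR⟩ := ψ.exists_diagonal_clm _ C hC
    have h0 : ∀ i, (lam i : 𝕜) - ζ ≠ 0 := fun i => sub_ne_zero.mpr (h i)
    refine ⟨R, fun x => ψ.ext_inner fun i => ?_, fun y => ?_⟩
    · have := (hA x (A x)).mp (A.mem_graph x) i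
      rw [hR, inner_sub_right, this, inner_smul_right, ← sub_mul, inv_mul_cancel_left₀ (h0 i)]
    · have hg : (R y, y + ζ • R y) ∈ A.graph := (hA _ _).mpr fun i => by
        rw [inner_add_right, inner_smul_right, hR]
        field_simp [h0 i]
        ring
      obtain ⟨x, hx, hx'⟩ := (LinearPMap.mem_graph_iff A).mp hg
      refine ⟨x, hx.symm, ?_⟩
      simp only at hx hx'
      rw [hx', hx, add_sub_cancel_right]

theorem IsDiagonal.spectrum_eq (hA : IsDiagonal A ψ lam)
    (hfin : ∀ R : ℝ, {i | |lam i| ≤ R}.Finite) :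
    spectrum A = {ζ | ∃ i, (lam i : 𝕜) = ζ} := by
  ext ζ
  rw [spectrum, Set.mem_compl_iff, hA.mem_resolventSet_iff hfin]
  simp

theorem IsDiagonal.hasPurelyDiscreteSpectrum (hA : IsDiagonal A ψ lam)
    (hfin : ∀ R : ℝ, {i | |lam i| ≤ R}.Finite) : HasPurelyDiscreteSpectrum A := by
  refine ⟨fun ζ hζ => ⟨?_, hA.finiteDimensional_eigenspace hfin ζ⟩, fun ζ hacc => ?_⟩
  · rw [hA.spectrum_eq hfin] at hζ
    exact (hA.eigenspace_ne_bot_iff ζ).mpr hζ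
  · rw [hA.spectrum_eq hfin] at hacc
    have hf : ({ζ' | ∃ i, (lam i : 𝕜) = ζ'} ∩ Metric.ball ζ 1).Finite := by
      refine ((hfin (‖ζ‖ + 1)).image fun i => (lam i : 𝕜)).subset ?_
      rintro _ ⟨⟨i, rfl⟩, hi⟩
      refine ⟨i, ?_, rfl⟩
      rw [mem_ball_iff_norm] at hi
      have := norm_sub_norm_le (lam i : 𝕜) ζ
      rw [RCLike.norm_ofReal] at this
      change |lam i| ≤ _
      linarith
    have := hacc.nhds_inter (Metric.ball_mem_nhds ζ one_pos)
    rw [inter_comm] at this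
    exact Set.Infinite.of_accPt this hf

end Diagonal

/-! ### Differential equations of the Laguerre and Hermite polynomials -/

/-- With the lower index `k + 1` in place of `ℓ - k`, the formula holds for all `k`: beyond the
degree the binomial coefficient vanishes, whereas the truncated `ℓ - k` would give 1. -/
theorem coeff_laguerre_one (ℓ k : ℕ) :
    (laguerre 1 ℓ).coeff k = (-1) ^ k * ((ℓ + 1).choose (k + 1) : ℝ) / (k.factorial : ℝ) := by
  simp only [laguerre, Polynomial.finsetSum_coeff, Polynomial.coeff_C_mul, Polynomial.coeff_X_pow,
    mul_ite, mul_one, mul_zero, Finset.sum_ite_eq, Finset.mem_range]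
  split_ifs with h
  · rw [← Nat.choose_symm_of_eq_add (n := ℓ + 1) (a := ℓ - k) (b := k + 1) (by omega)]
  · rw [Nat.choose_eq_zero_of_lt (by omega)]; simp

theorem laguerre_one_ode (ℓ : ℕ) :
    Polynomial.X * Polynomial.derivative (Polynomial.derivative (laguerre 1 ℓ)) +
      (2 - Polynomial.X) * Polynomial.derivative (laguerre 1 ℓ) +
      Polynomial.C (ℓ : ℝ) * laguerre 1 ℓ = 0 := by
  -- Comparing coefficients, the equation is this two-term recurrence.
  have key : ∀ k : ℕ, ((k : ℝ) + 1) * (k + 2) * (laguerre 1 ℓ).coeff (k + 1) +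
      (ℓ - k) * (laguerre 1 ℓ).coeff k = 0 := fun k => by
    rw [coeff_laguerre_one, coeff_laguerre_one, Nat.factorial_succ]
    have hc : ((ℓ + 1).choose (k + 2) : ℝ) * (k + 2) = (ℓ + 1).choose (k + 1) * (ℓ - k) := by
      have h := Nat.choose_succ_right_eq (ℓ + 1) (k + 1)
      rcases le_or_gt k ℓ with hk | hk
      · have h2 : ((ℓ + 1 - (k + 1) : ℕ) : ℝ) = ℓ - k := by
          rw [Nat.add_sub_add_right, Nat.cast_sub hk]
        rw [← h2]
        exact_mod_cast h
      · rw [Nat.choose_eq_zero_of_lt (by omega), Nat.choose_eq_zero_of_lt (by omega)]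
        simp
    have hf : (k.factorial : ℝ) ≠ 0 := by positivity
    push_cast
    field_simp
    rw [pow_succ]
    linear_combination -(-1 : ℝ) ^ k * hc
  ext k
  rcases k with _ | k
  · have := key 0
    simp [sub_mul, Polynomial.coeff_derivative, Polynomial.coeff_ofNat_mul] at this ⊢
    linarith
  · have := key (k + 1)
    simp [sub_mul, Polynomial.coeff_derivative, Polynomial.coeff_X_mul,
      Polynomial.coeff_ofNat_mul] at this ⊢
    linear_combination this

theorem hermite_ode (n : ℕ) :
    Polynomial.derivative (Polynomial.derivative (hermite n)) -
      2 * Polynomial.X * Polynomial.derivative (hermite n) + 2 * (n : Polynomial ℝ) * hermite n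
      = 0 := by
  induction n with
  | zero => simp [hermite]
  | succ n ih =>
    -- Differentiating the recursion and inserting the equation for `n` gives the lowering relation,
    -- from which the next equation is immediate.
    have h1 : Polynomial.derivative (hermite (n + 1)) =
        2 * ((n : Polynomial ℝ) + 1) * hermite n := by
      simp [hermite]
      linear_combination -ih
    rw [h1]
    simp [hermite]
    ring

theorem hermite_natDegree_le_and_coeff (n : ℕ) :
    (hermite n).natDegree ≤ n ∧ (hermite n).coeff n = 2 ^ n := by
  induction n with
  | zero => simp [hermite]
  | succ n ih =>
    have h2 : hermite (n + 1) = Polynomial.X * (2 * hermite n) -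
        Polynomial.derivative (hermite n) := by rw [hermite]; ring
    constructor
    · rw [h2]
      refine (Polynomial.natDegree_sub_le _ _).trans (max_le ?_ ?_)
      · refine (Polynomial.natDegree_mul_le).trans ?_
        have h3 : (2 * hermite n).natDegree ≤ n := by
          rw [show (2 : Polynomial ℝ) = Polynomial.C 2 from rfl]
          exact (Polynomial.natDegree_C_mul_le _ _).trans ih.1
        have := Polynomial.natDegree_X_le (R := ℝ)
        omega
      · have := Polynomial.natDegree_derivative_le (hermite n)
        omega
    · rw [h2, Polynomial.coeff_sub, Polynomial.coeff_X_mul, Polynomial.coeff_ofNat_mul, ih.2,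
        Polynomial.coeff_derivative, Polynomial.coeff_eq_zero_of_natDegree_lt (n := n + 1 + 1)
          (by omega)]
      ring

theorem degree_hermite (n : ℕ) : (hermite n).degree = n := by
  obtain ⟨h1, h2⟩ := hermite_natDegree_le_and_coeff n
  refine le_antisymm (Polynomial.natDegree_le_iff_degree_le.mp h1)
    (Polynomial.le_degree_of_ne_zero ?_)
  rw [h2]; positivity

theorem degree_laguerre_one (ℓ : ℕ) : (laguerre 1 ℓ).degree = ℓ := by
  refine le_antisymm ((Polynomial.degree_le_iff_coeff_zero _ _).mpr fun m hm => ?_)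
    (Polynomial.le_degree_of_ne_zero ?_)
  · rw [coeff_laguerre_one, Nat.choose_eq_zero_of_lt 
      (by exact_mod_cast Nat.succ_lt_succ (by exact_mod_cast hm))]
    simp
  · rw [coeff_laguerre_one]
    simp [Nat.factorial_ne_zero]

/-! ### Calculus of the differential expression -/

theorem dr_mul {f g : ℝ × ℝ → ℝ} (hf : ContDiff ℝ ∞ f) (hg : ContDiff ℝ ∞ g) :
    dr (fun p => f p * g p) = fun p => dr f p * g p + f p * dr g p := by
  ext p
  unfold dr
  rw [fderiv_fun_mul (hf.differentiable (by simp) p) (hg.differentiable (by simp) p)]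
  simp
  ring

theorem dz_mul {f g : ℝ × ℝ → ℝ} (hf : ContDiff ℝ ∞ f) (hg : ContDiff ℝ ∞ g) :
    dz (fun p => f p * g p) = fun p => dz f p * g p + f p * dz g p := by
  ext p
  unfold dz
  rw [fderiv_fun_mul (hf.differentiable (by simp) p) (hg.differentiable (by simp) p)]
  simp
  ring

theorem dr_add {f g : ℝ × ℝ → ℝ} (hf : ContDiff ℝ ∞ f) (hg : ContDiff ℝ ∞ g) :
    dr (fun p => f p + g p) = fun p => dr f p + dr g p := by
  ext p
  unfold dr
  rw [fderiv_fun_add (hf.differentiable (by simp) p) (hg.differentiable (by simp) p)]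
  simp

theorem dz_add {f g : ℝ × ℝ → ℝ} (hf : ContDiff ℝ ∞ f) (hg : ContDiff ℝ ∞ g) :
    dz (fun p => f p + g p) = fun p => dz f p + dz g p := by
  ext p
  unfold dz
  rw [fderiv_fun_add (hf.differentiable (by simp) p) (hg.differentiable (by simp) p)]
  simp

theorem diffExpr_mul {f g : ℝ × ℝ → ℝ} (hf : ContDiff ℝ ∞ f) (hg : ContDiff ℝ ∞ g) (p : ℝ × ℝ) :
    diffExpr (fun p => f p * g p) p = f p * diffExpr g p + g p * diffExpr f p -
      2 * (dr f p * dr g p + dz f p * dz g p) := by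
  unfold diffExpr
  rw [dr_mul hf hg, dz_mul hf hg, dr_add ((contDiff_dr hf).mul hg) (hf.mul (contDiff_dr hg)),
    dz_add ((contDiff_dz hf).mul hg) (hf.mul (contDiff_dz hg)), dr_mul (contDiff_dr hf) hg,
    dr_mul hf (contDiff_dr hg), dz_mul (contDiff_dz hf) hg, dz_mul hf (contDiff_dz hg)]
  ring

theorem dr_prod {u v : ℝ → ℝ} (hu : Differentiable ℝ u) (hv : Differentiable ℝ v) :
    dr (fun p => u p.1 * v p.2) = fun p => deriv u p.1 * v p.2 := by
  ext p
  have h1 : HasFDerivAt (fun p : ℝ × ℝ => u p.1) _ p :=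
    (hu p.1).hasDerivAt.hasFDerivAt.comp p hasFDerivAt_fst
  have h2 : HasFDerivAt (fun p : ℝ × ℝ => v p.2) _ p :=
    (hv p.2).hasDerivAt.hasFDerivAt.comp p hasFDerivAt_snd
  unfold dr
  rw [(h1.fun_mul h2).fderiv]
  simp [mul_comm]

theorem dz_prod {u v : ℝ → ℝ} (hu : Differentiable ℝ u) (hv : Differentiable ℝ v) :
    dz (fun p => u p.1 * v p.2) = fun p => u p.1 * deriv v p.2 := by
  ext p
  have h1 : HasFDerivAt (fun p : ℝ × ℝ => u p.1) _ p :=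
    (hu p.1).hasDerivAt.hasFDerivAt.comp p hasFDerivAt_fst
  have h2 : HasFDerivAt (fun p : ℝ × ℝ => v p.2) _ p :=
    (hv p.2).hasDerivAt.hasFDerivAt.comp p hasFDerivAt_snd
  unfold dz
  rw [(h1.fun_mul h2).fderiv]
  simp

theorem diffExpr_prod {u v : ℝ → ℝ} (hu : ContDiff ℝ ∞ u) (hv : ContDiff ℝ ∞ v) (p : ℝ × ℝ) :
    diffExpr (fun p => u p.1 * v p.2) p =
      (-deriv (deriv u) p.1 + p.1 / 2 * deriv u p.1 - 3 / p.1 * deriv u p.1) * v p.2 +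
      u p.1 * (-deriv (deriv v) p.2 + p.2 / 2 * deriv v p.2) := by
  have hu0 := hu.differentiable (by simp)
  have hv0 := hv.differentiable (by simp)
  have hu1 := (contDiff_infty_iff_deriv.mp hu).2.differentiable (by simp)
  have hv1 := (contDiff_infty_iff_deriv.mp hv).2.differentiable (by simp)
  unfold diffExpr
  rw [dr_prod hu0 hv0, dz_prod hu0 hv0, dr_prod hu1 hv0, dz_prod hu0 hv1]
  ring

theorem contDiff_eigenfun (ℓ n : ℕ) : ContDiff ℝ ∞ (eigenfun ℓ n) := by
  unfold eigenfun
  have h : ∀ P : Polynomial ℝ, ContDiff ℝ ∞ fun x => P.eval x := fun P => by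
    simpa using P.contDiff_aeval (𝕜 := ℝ) ∞
  exact ((h _).comp (by fun_prop : ContDiff ℝ ∞ fun p : ℝ × ℝ => p.1 ^ 2 / 4)).mul
    ((h _).comp (by fun_prop : ContDiff ℝ ∞ fun p : ℝ × ℝ => p.2 / 2))

/-- For `u(r) = P(r²/4)` and `x = r²/4` the radial part becomes `-(x P'' + (2 - x) P')`; the term
`3/r` is what produces the parameter 1. For `v(z) = Q(z/2)` and `y = z/2` the other part is `-(Q'' -
2 y Q')/4`. -/
theorem diffExpr_eigenfun (ℓ n : ℕ) (p : ℝ × ℝ) (hp : p ∈ halfPlane) :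
    diffExpr (eigenfun ℓ n) p = eigenval ℓ n * eigenfun ℓ n p := by
  have hp0 : p.1 ≠ 0 := ne_of_gt hp
  have h : ∀ P : Polynomial ℝ, ContDiff ℝ ∞ fun x => P.eval x := fun P => by
    simpa using P.contDiff_aeval (𝕜 := ℝ) ∞
  have hu1 : ∀ P : Polynomial ℝ, deriv (fun r : ℝ => P.eval (r ^ 2 / 4)) =
      fun r => P.derivative.eval (r ^ 2 / 4) * (r / 2) := fun P => by
    ext r
    have h1 : HasDerivAt (fun r : ℝ => r ^ 2 / 4) (r / 2) r := by
      refine ((hasDerivAt_pow 2 r).div_const 4).congr_deriv ?_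
      norm_num; ring
    exact ((P.hasDerivAt _).comp r h1).deriv
  have hv1 : ∀ P : Polynomial ℝ, deriv (fun z : ℝ => P.eval (z / 2)) =
      fun z => P.derivative.eval (z / 2) * (1 / 2) := fun P => by
    ext z
    exact ((P.hasDerivAt _).comp z ((hasDerivAt_id z).div_const 2)).deriv
  have e : eigenfun ℓ n = fun p => (fun r : ℝ => (laguerre 1 ℓ).eval (r ^ 2 / 4)) p.1 *
    (fun z : ℝ => (hermite n).eval (z / 2)) p.2 := rfl
  have hu0 : ContDiff ℝ ∞ fun r : ℝ => (laguerre 1 ℓ).eval (r ^ 2 / 4) :=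
    (h _).comp (by fun_prop : ContDiff ℝ ∞ fun r : ℝ => r ^ 2 / 4)
  have hv0 : ContDiff ℝ ∞ fun z : ℝ => (hermite n).eval (z / 2) :=
    (h _).comp (by fun_prop : ContDiff ℝ ∞ fun z : ℝ => z / 2)
  rw [e, diffExpr_prod hu0 hv0, hu1, hv1]
  have hu2 : deriv (fun r : ℝ => (laguerre 1 ℓ).derivative.eval (r ^ 2 / 4) * (r / 2)) p.1 =
      (laguerre 1 ℓ).derivative.derivative.eval (p.1 ^ 2 / 4) * (p.1 / 2) * (p.1 / 2) +
      (laguerre 1 ℓ).derivative.eval (p.1 ^ 2 / 4) * (1 / 2) := by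
    rw [deriv_fun_mul, hu1]
    · simp
    · exact ((h _).comp (by fun_prop : ContDiff ℝ ∞ fun r : ℝ => r ^ 2 / 4)).differentiable
        (by simp) _
    · fun_prop
  have hv2 : deriv (fun z : ℝ => (hermite n).derivative.eval (z / 2) * (1 / 2)) p.2 =
      (hermite n).derivative.derivative.eval (p.2 / 2) * (1 / 2) * (1 / 2) := by
    rw [deriv_mul_const_field, hv1]
  rw [hu2, hv2]
  have h1 := congrArg (Polynomial.eval (p.1 ^ 2 / 4)) (laguerre_one_ode ℓ)
  have h2 := congrArg (Polynomial.eval (p.2 / 2)) (hermite_ode n)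
  simp at h1 h2
  unfold eigenval
  field_simp
  linear_combination (-4 * (hermite n).eval (p.2 / 2)) * h1 - (laguerre 1 ℓ).eval (p.1 ^ 2 / 4) * h2

/-! ### Integration with respect to `μ` -/

theorem density_nonneg {p : ℝ × ℝ} (hp : p ∈ halfPlane) : 0 ≤ density p := by
  have : 0 < p.1 := hp
  unfold density
  positivity

theorem integral_mu {F : Type*} [NormedAddCommGroup F] [NormedSpace ℝ F] (h : ℝ × ℝ → F) :
    ∫ p, h p ∂mu = ∫ p in halfPlane, density p • h p := by
  unfold mu
  rw [integral_withDensity_eq_integral_toReal_smul continuous_density.measurable.ennreal_ofReal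
    (by simp)]
  refine setIntegral_congr_fun isOpen_halfPlane.measurableSet fun p hp => ?_
  simp only [ENNReal.toReal_ofReal (density_nonneg hp)]

theorem integrable_mu_iff {F : Type*} [NormedAddCommGroup F] [NormedSpace ℝ F]
    (h : ℝ × ℝ → F) :
    Integrable h mu ↔ IntegrableOn (fun p => density p • h p) halfPlane := by
  unfold mu
  rw [integrable_withDensity_iff_integrable_smul' continuous_density.measurable.ennreal_ofReal
    (by simp)]
  refine integrableOn_congr_fun (fun p hp => ?_) isOpen_halfPlane.measurableSet
  simp only [ENNReal.toReal_ofReal (density_nonneg hp)]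

theorem integrable_pow_three_mul_exp {b : ℝ} (hb : 0 < b) :
    Integrable fun r : ℝ => r ^ 3 * Real.exp (-b * r ^ 2) := by
  have := integrable_rpow_mul_exp_neg_mul_sq hb (s := 3) (by norm_num)
  refine this.congr (.of_forall fun r => ?_)
  dsimp only
  rw [show (3 : ℝ) = ((3 : ℕ) : ℝ) by norm_num, Real.rpow_natCast]

theorem integrable_mu_exp {c : ℝ} (hc : c < 1 / 4) :
    Integrable (fun p : ℝ × ℝ => Real.exp (c * (p.1 ^ 2 + p.2 ^ 2))) mu := by
  rw [integrable_mu_iff]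
  have h := (integrable_pow_three_mul_exp (b := 1 / 4 - c) (by linarith)).mul_prod
    (integrable_exp_neg_mul_sq (b := 1 / 4 - c) (by linarith))
  rw [← Measure.volume_eq_prod] at h
  refine ((h.const_mul (1 / (16 * √Real.pi))).congr (.of_forall fun p => ?_)).integrableOn
  simp only [density, smul_eq_mul]
  rw [mul_assoc _ (Real.exp _), ← Real.exp_add, mul_assoc _ (Real.exp _), ← Real.exp_add, ← mul_assoc]
  ring_nf

instance : IsFiniteMeasure mu := by
  have := integrable_mu_exp (c := 0) (by norm_num)
  simpa [integrable_const_iff] using this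

/-- The functions bounded by a multiple of `exp (c (r² + z²))`. -/
def GaussBound {F : Type*} [NormedAddCommGroup F] (c : ℝ) (h : ℝ × ℝ → F) : Prop :=
  ∃ C : ℝ, ∀ p, ‖h p‖ ≤ C * Real.exp (c * (p.1 ^ 2 + p.2 ^ 2))

/-- Squaring doubles the exponent, so the threshold 1/4 set by the density becomes 1/8. -/
theorem GaussBound.memLp {F : Type*} [NormedAddCommGroup F] {c : ℝ} {h : ℝ × ℝ → F}
    (hh : GaussBound c h) (hc : c < 1 / 8) (hm : AEStronglyMeasurable h mu) : MemLp h 2 mu := by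
  obtain ⟨C, hC⟩ := hh
  rw [memLp_two_iff_integrable_sq_norm hm]
  refine ((integrable_mu_exp (c := 2 * c) (by linarith)).const_mul (C ^ 2)).mono'
    (hm.norm.pow 2) (.of_forall fun p => ?_)
  rw [Real.norm_of_nonneg (by positivity)]
  refine (pow_le_pow_left₀ (norm_nonneg _) (hC p) 2).trans_eq ?_
  rw [mul_pow, ← Real.exp_nat_mul]
  ring_nf

theorem GaussBound.mul {c d : ℝ} {h k : ℝ × ℝ → ℝ} (hh : GaussBound c h) (hk : GaussBound d k) :
    GaussBound (c + d) fun p => h p * k p := by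
  obtain ⟨C, hC⟩ := hh
  obtain ⟨D, hD⟩ := hk
  refine ⟨C * D, fun p => ?_⟩
  rw [norm_mul, add_mul, Real.exp_add, mul_mul_mul_comm]
  exact mul_le_mul (hC p) (hD p) (norm_nonneg _) ((norm_nonneg _).trans (hC p))

theorem GaussBound.mono {F G : Type*} [NormedAddCommGroup F] [NormedAddCommGroup G] {c : ℝ}
    {h : ℝ × ℝ → F} {k : ℝ × ℝ → G} (hk : GaussBound c k) (hle : ∀ p, ‖h p‖ ≤ ‖k p‖) :
    GaussBound c h := by
  obtain ⟨C, hC⟩ := hk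
  exact ⟨C, fun p => (hle p).trans (hC p)⟩

theorem gaussBound_exp_abs (t : ℝ) {c : ℝ} (hc : 0 < c) :
    GaussBound c fun p : ℝ × ℝ => Real.exp (|t| * |p.2|) := by
  refine ⟨Real.exp (t ^ 2 / (4 * c)), fun p => ?_⟩
  rw [Real.norm_of_nonneg (by positivity), ← Real.exp_add, Real.exp_le_exp]
  have h1 : 0 ≤ c * (|p.2| - |t| / (2 * c)) ^ 2 := by positivity
  have h2 : c * (|p.2| - |t| / (2 * c)) ^ 2 = c * p.2 ^ 2 - |t| * |p.2| + t ^ 2 / (4 * c) := by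
    rw [← sq_abs p.2, ← sq_abs t]
    field_simp
    ring
  nlinarith [sq_nonneg p.1]

/-- Combines `x ^ k ≤ k! exp x` with `‖p‖ ≤ c ‖p‖² + 1/(4c)`; polynomial growth thus costs an
arbitrarily small Gaussian exponent. -/
theorem GaussBound.of_poly {F : Type*} [NormedAddCommGroup F] {c C : ℝ} {k : ℕ} {h : ℝ × ℝ → F}
    (hc : 0 < c) (hh : ∀ p, ‖h p‖ ≤ C * (1 + ‖p‖) ^ k) : GaussBound c h := by
  refine ⟨|C| * (k.factorial * Real.exp (1 + 1 / (4 * c))), fun p => (hh p).trans ?_⟩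
  have h0 : 0 ≤ 1 + ‖p‖ := by positivity
  have h1 := Real.pow_div_factorial_le_exp _ h0 k
  rw [div_le_iff₀ (by positivity)] at h1
  have h2 : ‖p‖ ^ 2 ≤ p.1 ^ 2 + p.2 ^ 2 := by
    rw [Prod.norm_def]
    rcases max_choice ‖p.1‖ ‖p.2‖ with h | h <;> rw [h, Real.norm_eq_abs, sq_abs]
    · nlinarith [sq_nonneg p.2]
    · nlinarith [sq_nonneg p.1]
  have h3 : 1 + ‖p‖ ≤ (1 + 1 / (4 * c)) + c * (p.1 ^ 2 + p.2 ^ 2) := by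
    have h1 : 0 ≤ c * (‖p‖ - 1 / (2 * c)) ^ 2 := by positivity
    have h2' : c * (‖p‖ - 1 / (2 * c)) ^ 2 = c * ‖p‖ ^ 2 - ‖p‖ + 1 / (4 * c) := by
      field_simp
      ring
    nlinarith
  have h4 := Real.exp_le_exp.mpr h3
  rw [Real.exp_add _ (c * _)] at h4
  calc C * (1 + ‖p‖) ^ k ≤ |C| * (1 + ‖p‖) ^ k := by gcongr; exact le_abs_self C
    _ ≤ |C| * (Real.exp (1 + 1 / (4 * c)) * Real.exp (c * (p.1 ^ 2 + p.2 ^ 2)) * k.factorial) := by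
      gcongr
      exact h1.trans (by gcongr)
    _ = _ := by ring

theorem _root_.Function.HasTemperateGrowth.gaussBound {F : Type*} [NormedAddCommGroup F]
    [NormedSpace ℝ F] {h : ℝ × ℝ → F} (hh : h.HasTemperateGrowth) {c : ℝ} (hc : 0 < c) :
    GaussBound c h := by
  obtain ⟨k, C, hC⟩ := hh.2 0
  exact .of_poly hc fun p => by simpa using hC p

theorem _root_.Function.HasTemperateGrowth.gaussBound_fderiv {F : Type*} [NormedAddCommGroup F]
    [NormedSpace ℝ F] {h : ℝ × ℝ → F} (hh : h.HasTemperateGrowth) {c : ℝ} (hc : 0 < c)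
    : GaussBound c (fderiv ℝ h) := by
  obtain ⟨k, C, hC⟩ := hh.2 1
  exact .of_poly hc fun p => by simpa [norm_iteratedFDeriv_one] using hC p

theorem hasTemperateGrowth_polynomial {E : Type*} [NormedAddCommGroup E] [NormedSpace ℝ E]
    (P : Polynomial ℝ) {f : E → ℝ} (hf : f.HasTemperateGrowth) :
    (fun x => P.eval (f x)).HasTemperateGrowth := by
  induction P using Polynomial.induction_on' with
  | add P Q hP hQ => simp only [Polynomial.eval_add]; fun_prop
  | monomial n a => simp only [Polynomial.eval_monomial]; fun_prop

theorem hasTemperateGrowth_fst : (fun p : ℝ × ℝ => p.1).HasTemperateGrowth :=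
  (ContinuousLinearMap.fst ℝ ℝ ℝ).hasTemperateGrowth

theorem hasTemperateGrowth_snd : (fun p : ℝ × ℝ => p.2).HasTemperateGrowth :=
  (ContinuousLinearMap.snd ℝ ℝ ℝ).hasTemperateGrowth

/-- The function `(r, z) ↦ P(r²/4) Q(z/2)`. -/
noncomputable def polyFun (P Q : Polynomial ℝ) (p : ℝ × ℝ) : ℝ :=
  P.eval (p.1 ^ 2 / 4) * Q.eval (p.2 / 2)

theorem hasTemperateGrowth_polyFun (P Q : Polynomial ℝ) : (polyFun P Q).HasTemperateGrowth := by
  have h1 := hasTemperateGrowth_fst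
  have h2 := hasTemperateGrowth_snd
  refine (hasTemperateGrowth_polynomial P (f := fun p : ℝ × ℝ => p.1 ^ 2 / 4) ?_).fun_mul
    (hasTemperateGrowth_polynomial Q (f := fun p : ℝ × ℝ => p.2 / 2) ?_)
  · simp only [div_eq_mul_inv]; fun_prop
  · simp only [div_eq_mul_inv]; fun_prop

theorem memLp_polyFun (P Q : Polynomial ℝ) : MemLp (polyFun P Q) 2 mu :=
  ((hasTemperateGrowth_polyFun P Q).gaussBound (c := 1 / 16) (by norm_num)).memLp (by norm_num)
    (hasTemperateGrowth_polyFun P Q).1.continuous.aestronglyMeasurable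

theorem hasTemperateGrowth_eigenfun (ℓ n : ℕ) : (eigenfun ℓ n).HasTemperateGrowth :=
  hasTemperateGrowth_polyFun _ _

theorem memLp_eigenfun (ℓ n : ℕ) : MemLp (eigenfun ℓ n) 2 mu := memLp_polyFun _ _

theorem integral_mu_prod (u v : ℝ → ℝ) :
    ∫ p, u p.1 * v p.2 ∂mu = 1 / (16 * √Real.pi) *
      ((∫ r in Ioi 0, r ^ 3 * Real.exp (-r ^ 2 / 4) * u r) *
        ∫ z, Real.exp (-z ^ 2 / 4) * v z) := by
  have e : halfPlane = Ioi 0 ×ˢ univ := by ext p; simp [halfPlane]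
  have h := setIntegral_prod_mul (μ := volume) (ν := volume)
    (fun r : ℝ => r ^ 3 * Real.exp (-r ^ 2 / 4) * u r)
    (fun z : ℝ => Real.exp (-z ^ 2 / 4) * v z) (Ioi 0) univ
  rw [Measure.restrict_univ, ← Measure.volume_eq_prod] at h
  rw [integral_mu, e, ← h, ← integral_const_mul]
  refine integral_congr_ae (.of_forall fun p => ?_)
  simp only [density, smul_eq_mul]
  rw [neg_add, add_div, Real.exp_add]
  ring

/-! ### Symmetry of the differential expression -/

theorem density_eq : density = fun p => (fun r : ℝ => 1 / (16 * √Real.pi) * r ^ 3 *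
    Real.exp (-r ^ 2 / 4)) p.1 * (fun z : ℝ => Real.exp (-z ^ 2 / 4)) p.2 := by
  ext p
  simp only [density]
  rw [neg_add, add_div, Real.exp_add]
  ring

theorem contDiff_density : ContDiff ℝ ∞ density := by
  unfold density
  fun_prop

/-- The logarithmic derivatives of the density are the negatives of the first-order coefficients of
`diffExpr`; this is the source of symmetry. -/
theorem dr_density {p : ℝ × ℝ} (hp : p.1 ≠ 0) :
    dr density p = (3 / p.1 - p.1 / 2) * density p := by
  rw [density_eq, dr_prod (u := fun r : ℝ => 1 / (16 * √Real.pi) * r ^ 3 * Real.exp (-r ^ 2 / 4))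
    (v := fun z : ℝ => Real.exp (-z ^ 2 / 4)) (by fun_prop) (by fun_prop)]
  have h1 : HasDerivAt (fun r : ℝ => Real.exp (-r ^ 2 / 4)) _ p.1 :=
    ((hasDerivAt_pow 2 p.1).fun_neg.div_const 4).exp
  have h2 := ((hasDerivAt_pow 3 p.1).const_mul (1 / (16 * √Real.pi))).fun_mul h1
  dsimp only
  rw [h2.deriv]
  simp
  field_simp
  ring

theorem dz_density (p : ℝ × ℝ) : dz density p = -(p.2 / 2) * density p := by
  rw [density_eq, dz_prod (u := fun r : ℝ => 1 / (16 * √Real.pi) * r ^ 3 * Real.exp (-r ^ 2 / 4))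
    (v := fun z : ℝ => Real.exp (-z ^ 2 / 4)) (by fun_prop) (by fun_prop)]
  have h1 : HasDerivAt (fun r : ℝ => Real.exp (-r ^ 2 / 4)) _ p.2 :=
    ((hasDerivAt_pow 2 p.2).fun_neg.div_const 4).exp
  dsimp only
  rw [h1.deriv]
  simp
  ring

theorem integral_fderiv_apply_eq_zero {E : Type*} [NormedAddCommGroup E] [NormedSpace ℝ E]
    [FiniteDimensional ℝ E] [MeasurableSpace E] [BorelSpace E] (μ : Measure E)
    [μ.IsAddHaarMeasure] {f : E → ℝ} (hf : ContDiff ℝ 1 f) (hc : HasCompactSupport f) (v : E) :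
    ∫ x, fderiv ℝ f x v ∂μ = 0 := by
  have hi : Integrable (fun x => fderiv ℝ f x v) μ :=
    ((hf.continuous_fderiv (by simp)).clm_apply continuous_const).integrable_of_hasCompactSupport
      (hc.fderiv_apply ℝ v)
  have h := integral_mul_fderiv_eq_neg_fderiv_mul_of_integrable (μ := μ) (f := fun _ : E => (1 : ℝ))
    (g := f) (v := v) (by simp) (by simpa using hi)
    (by simpa using hf.continuous.integrable_of_hasCompactSupport hc) (by fun_prop)
    (fun x _ => hf.differentiable (by simp) x)
  simpa using h

theorem dr_sub {f g : ℝ × ℝ → ℝ} (hf : ContDiff ℝ ∞ f) (hg : ContDiff ℝ ∞ g) :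
    dr (fun p => f p - g p) = fun p => dr f p - dr g p := by
  ext p
  unfold dr
  rw [fderiv_fun_sub (hf.differentiable (by simp) p) (hg.differentiable (by simp) p)]
  simp

theorem dz_sub {f g : ℝ × ℝ → ℝ} (hf : ContDiff ℝ ∞ f) (hg : ContDiff ℝ ∞ g) :
    dz (fun p => f p - g p) = fun p => dz f p - dz g p := by
  ext p
  unfold dz
  rw [fderiv_fun_sub (hf.differentiable (by simp) p) (hg.differentiable (by simp) p)]
  simp

/-- Green's identity: the difference of the integrands is minus the divergence of the field `(Fr,
Fz)`, which is smooth and compactly supported on the whole plane, so its divergence integrates to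
zero. Only one of the functions needs compact support. -/
theorem integral_diffExpr_symm {φ ψ : ℝ × ℝ → ℝ} (hφ : IsTest φ) (hψ : ContDiff ℝ ∞ ψ) :
    ∫ p, diffExpr φ p * ψ p ∂mu = ∫ p in halfPlane, density p * (φ p * diffExpr ψ p) := by
  have h0 : ∀ p, p ∉ tsupport φ → φ p = 0 ∧ dr φ p = 0 ∧ dz φ p = 0 ∧ dr (dr φ) p = 0 ∧
      dz (dz φ) p = 0 ∧ diffExpr φ p = 0 := fun p hp =>
    ⟨image_eq_zero_of_notMem_tsupport hp,
      image_eq_zero_of_notMem_tsupport fun h => hp (tsupport_dr_subset φ h),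
      image_eq_zero_of_notMem_tsupport fun h => hp (tsupport_dz_subset φ h),
      image_eq_zero_of_notMem_tsupport fun h => hp (tsupport_dr_subset φ (tsupport_dr_subset _ h)),
      image_eq_zero_of_notMem_tsupport fun h => hp (tsupport_dz_subset φ (tsupport_dz_subset _ h)),
      image_eq_zero_of_notMem_tsupport fun h => hp (tsupport_diffExpr_subset φ h)⟩
  have cφr := contDiff_dr hφ.1
  have cφz := contDiff_dz hφ.1
  have cψr := contDiff_dr hψ
  have cψz := contDiff_dz hψ
  let Fr : ℝ × ℝ → ℝ := fun p => density p * (ψ p * dr φ p - φ p * dr ψ p)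
  let Fz : ℝ × ℝ → ℝ := fun p => density p * (ψ p * dz φ p - φ p * dz ψ p)
  have cFr : ContDiff ℝ ∞ Fr := contDiff_density.mul ((hψ.mul cφr).sub (hφ.1.mul cψr))
  have cFz : ContDiff ℝ ∞ Fz := contDiff_density.mul ((hψ.mul cφz).sub (hφ.1.mul cψz))
  have sFr : HasCompactSupport Fr := HasCompactSupport.intro' hφ.2.1 (isClosed_tsupport φ)
    fun p hp => by simp [Fr, (h0 p hp).1, (h0 p hp).2.1]
  have sFz : HasCompactSupport Fz := HasCompactSupport.intro' hφ.2.1 (isClosed_tsupport φ)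
    fun p hp => by simp [Fz, (h0 p hp).1, (h0 p hp).2.2.1]
  have ir : ∫ p, dr Fr p = 0 :=
    integral_fderiv_apply_eq_zero volume (cFr.of_le (by simp)) sFr (1, 0)
  have iz : ∫ p, dz Fz p = 0 :=
    integral_fderiv_apply_eq_zero volume (cFz.of_le (by simp)) sFz (0, 1)
  have irI : Integrable fun p => dr Fr p :=
    (contDiff_dr cFr).continuous.integrable_of_hasCompactSupport (sFr.fderiv_apply ℝ (1, 0))
  have izI : Integrable fun p => dz Fz p :=
    (contDiff_dz cFz).continuous.integrable_of_hasCompactSupport (sFz.fderiv_apply ℝ (0, 1))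
  have key : ∀ p, density p * (diffExpr φ p * ψ p) - density p * (φ p * diffExpr ψ p) =
      -(dr Fr p + dz Fz p) := fun p => by
    have e1 : dr Fr p = dr density p * (ψ p * dr φ p - φ p * dr ψ p) +
        density p * (ψ p * dr (dr φ) p - φ p * dr (dr ψ) p) := by
      simp only [Fr]
      rw [dr_mul contDiff_density ((hψ.mul cφr).sub (hφ.1.mul cψr)),
        dr_sub (hψ.mul cφr) (hφ.1.mul cψr), dr_mul hψ cφr, dr_mul hφ.1 cψr]
      ring
    have e2 : dz Fz p = dz density p * (ψ p * dz φ p - φ p * dz ψ p) +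
        density p * (ψ p * dz (dz φ) p - φ p * dz (dz ψ) p) := by
      simp only [Fz]
      rw [dz_mul contDiff_density ((hψ.mul cφz).sub (hφ.1.mul cψz)),
        dz_sub (hψ.mul cφz) (hφ.1.mul cψz), dz_mul hψ cφz, dz_mul hφ.1 cψz]
      ring
    rw [e1, e2]
    -- The formula for `dr density` needs `p.1 ≠ 0`, which holds on the support of `φ`; elsewhere
    -- every term vanishes.
    by_cases hp : p ∈ tsupport φ
    · rw [dr_density (ne_of_gt (hφ.2.2 hp)), dz_density]
      unfold diffExpr
      ring
    · obtain ⟨a, b, c, d, e, f⟩ := h0 p hp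
      simp [a, b, c, d, e, f]
  have hcL : Continuous fun p => density p * (diffExpr φ p * ψ p) :=
    continuous_density.mul (hφ.continuous_diffExpr.mul hψ.continuous)
  have hiL : Integrable fun p => density p * (diffExpr φ p * ψ p) :=
    hcL.integrable_of_hasCompactSupport
      (HasCompactSupport.intro' hφ.2.1 (isClosed_tsupport φ) fun p hp => by
        simp [(h0 p hp).2.2.2.2.2])
  have isum : Integrable fun p => dr Fr p + dz Fz p := irI.add izI
  have hR : (fun p => density p * (φ p * diffExpr ψ p)) =
      fun p => density p * (diffExpr φ p * ψ p) + (dr Fr p + dz Fz p) := by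
    ext p; linarith [key p]
  rw [integral_mu]
  simp only [smul_eq_mul]
  rw [setIntegral_eq_integral_of_forall_compl_eq_zero (s := halfPlane) fun p hp => by
      simp [(h0 p fun h => hp (hφ.2.2 h)).2.2.2.2.2],
    setIntegral_eq_integral_of_forall_compl_eq_zero (s := halfPlane) fun p hp => by
      simp [(h0 p fun h => hp (hφ.2.2 h)).1],
    hR, integral_add hiL isum, integral_add irI izI, ir, iz]
  simp

/-! ### Real functions as elements of `L²(μ)` -/

/-- A real square integrable function as an element of `L²(μ)`. -/
noncomputable def toL2 (𝕜 : Type*) [RCLike 𝕜] (u : ℝ × ℝ → ℝ) (hu : MemLp u 2 mu) : Lp 𝕜 2 mu :=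
  MemLp.toLp (fun p => ((u p : ℝ) : 𝕜)) hu.ofReal

variable {𝕜 : Type*} [RCLike 𝕜]

theorem coeFn_toL2 {u : ℝ × ℝ → ℝ} (hu : MemLp u 2 mu) :
    (toL2 𝕜 u hu : ℝ × ℝ → 𝕜) =ᵐ[mu] fun p => ((u p : ℝ) : 𝕜) :=
  MemLp.coeFn_toLp _

theorem inner_toL2 {u : ℝ × ℝ → ℝ} (hu : MemLp u 2 mu) (f : Lp 𝕜 2 mu) :
    inner 𝕜 (toL2 𝕜 u hu) f = ∫ p, u p • f p ∂mu := by
  rw [L2.inner_def]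
  refine integral_congr_ae ?_
  filter_upwards [coeFn_toL2 (𝕜 := 𝕜) hu] with p hp
  rw [hp, RCLike.inner_apply, RCLike.conj_ofReal, RCLike.real_smul_eq_coe_mul, mul_comm]

theorem inner_toL2_toL2 {u v : ℝ × ℝ → ℝ} (hu : MemLp u 2 mu) (hv : MemLp v 2 mu) :
    inner 𝕜 (toL2 𝕜 u hu) (toL2 𝕜 v hv) = ((∫ p, u p * v p ∂mu : ℝ) : 𝕜) := by
  rw [inner_toL2, ← integral_ofReal]
  refine integral_congr_ae ?_
  filter_upwards [coeFn_toL2 (𝕜 := 𝕜) hv] with p hp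
  rw [hp, RCLike.real_smul_eq_coe_mul, RCLike.ofReal_mul]

theorem IsTest.memLp {φ : ℝ × ℝ → ℝ} (hφ : IsTest φ) : MemLp φ 2 mu :=
  hφ.1.continuous.memLp_of_hasCompactSupport hφ.2.1

theorem IsTest.memLp_diffExpr {φ : ℝ × ℝ → ℝ} (hφ : IsTest φ) : MemLp (diffExpr φ) 2 mu :=
  hφ.continuous_diffExpr.memLp_of_hasCompactSupport hφ.hasCompactSupport_diffExpr

/-- Puts the weak equation into inner products, to which Parseval's identity applies. -/
theorem mem_opGraph_iff (x : Lp 𝕜 2 mu × Lp 𝕜 2 mu) :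
    x ∈ opGraph 𝕜 ↔ ∀ (φ : ℝ × ℝ → ℝ) (hφ : IsTest φ),
      inner 𝕜 (toL2 𝕜 _ hφ.memLp_diffExpr) x.1 = inner 𝕜 (toL2 𝕜 _ hφ.memLp) x.2 := by
  simp only [inner_toL2]
  rfl

theorem eigenfun_mem_opGraph (ℓ n : ℕ) :
    (toL2 𝕜 _ (memLp_eigenfun ℓ n), (eigenval ℓ n : 𝕜) • toL2 𝕜 _ (memLp_eigenfun ℓ n)) ∈
      opGraph 𝕜 := by
  rw [mem_opGraph_iff]
  intro φ hφ
  rw [inner_smul_right, inner_toL2_toL2, inner_toL2_toL2, ← RCLike.ofReal_mul,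
    integral_diffExpr_symm hφ (contDiff_eigenfun ℓ n), ← integral_const_mul, integral_mu]
  congr 1
  refine setIntegral_congr_fun isOpen_halfPlane.measurableSet fun p hp => ?_
  simp only [diffExpr_eigenfun ℓ n p hp, smul_eq_mul]
  ring

/-! ### Cut-off functions -/

theorem dr_comp {G : ℝ → ℝ} {w : ℝ × ℝ → ℝ} (hG : Differentiable ℝ G) (hw : Differentiable ℝ w) :
    dr (fun p => G (w p)) = fun p => deriv G (w p) * dr w p := by
  ext p
  have h := (hG (w p)).hasDerivAt.comp_hasFDerivAt p (hw p).hasFDerivAt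
  unfold dr
  rw [show (fun p => G (w p)) = G ∘ w from rfl, h.fderiv]
  simp

theorem dz_comp {G : ℝ → ℝ} {w : ℝ × ℝ → ℝ} (hG : Differentiable ℝ G) (hw : Differentiable ℝ w) :
    dz (fun p => G (w p)) = fun p => deriv G (w p) * dz w p := by
  ext p
  have h := (hG (w p)).hasDerivAt.comp_hasFDerivAt p (hw p).hasFDerivAt
  unfold dz
  rw [show (fun p => G (w p)) = G ∘ w from rfl, h.fderiv]
  simp

theorem contDiff_smoothTransition : ContDiff ℝ ∞ Real.smoothTransition :=
  Real.smoothTransition.contDiff (n := ⊤)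

theorem contDiff_deriv_smoothTransition : ContDiff ℝ ∞ (deriv Real.smoothTransition) :=
  (contDiff_infty_iff_deriv.mp contDiff_smoothTransition).2

theorem deriv_smoothTransition_eq_zero {x : ℝ} (hx : x ∉ Icc (0 : ℝ) 1) :
    deriv Real.smoothTransition x = 0 ∧ deriv (deriv Real.smoothTransition) x = 0 := by
  have h : ∀ y ∉ Icc (0 : ℝ) 1, deriv Real.smoothTransition y = 0 := fun y hy => by
    have : ∃ c, Real.smoothTransition =ᶠ[𝓝 y] fun _ => c := by
      rcases not_and_or.mp hy with h | h
      · exact ⟨0, by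
          filter_upwards [Iio_mem_nhds (not_le.mp h)] with z hz
          exact Real.smoothTransition.zero_of_nonpos (le_of_lt hz)⟩
      · exact ⟨1, by
          filter_upwards [Ioi_mem_nhds (not_le.mp h)] with z hz
          exact Real.smoothTransition.one_of_one_le (le_of_lt hz)⟩
    obtain ⟨c, hc⟩ := this
    rw [hc.deriv_eq, deriv_const]
  refine ⟨h x hx, ?_⟩
  have : deriv Real.smoothTransition =ᶠ[𝓝 x] fun _ => 0 := by
    filter_upwards [isClosed_Icc.isOpen_compl.mem_nhds hx] with y hy using h y hy
  rw [this.deriv_eq, deriv_const]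

theorem exists_bound_deriv_smoothTransition : ∃ C : ℝ, 1 ≤ C ∧ ∀ x,
    |deriv Real.smoothTransition x| ≤ C ∧ |deriv (deriv Real.smoothTransition) x| ≤ C := by
  obtain ⟨C1, h1⟩ := isCompact_Icc.exists_bound_of_continuousOn (s := Icc (0 : ℝ) 1)
    contDiff_deriv_smoothTransition.continuous.continuousOn
  obtain ⟨C2, h2⟩ := isCompact_Icc.exists_bound_of_continuousOn (s := Icc (0 : ℝ) 1)
    (contDiff_infty_iff_deriv.mp contDiff_deriv_smoothTransition).2.continuous.continuousOn
  refine ⟨max 1 (max C1 C2), le_max_left _ _, fun x => ?_⟩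
  by_cases hx : x ∈ Icc (0 : ℝ) 1
  · exact ⟨(h1 x hx).trans (by simp), (h2 x hx).trans (by simp)⟩
  · rw [(deriv_smoothTransition_eq_zero hx).1, (deriv_smoothTransition_eq_zero hx).2]
    simp

theorem hasFDerivAt_fst_real (p : ℝ × ℝ) :
    HasFDerivAt (fun p : ℝ × ℝ => p.1) (ContinuousLinearMap.fst ℝ ℝ ℝ) p := hasFDerivAt_fst

theorem hasFDerivAt_snd_real (p : ℝ × ℝ) :
    HasFDerivAt (fun p : ℝ × ℝ => p.2) (ContinuousLinearMap.snd ℝ ℝ ℝ) p := hasFDerivAt_snd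

/-- The cut-off function near the axis `r = 0`. -/
noncomputable def axisCutoff (K : ℝ) (p : ℝ × ℝ) : ℝ := Real.smoothTransition (K * p.1 - 1)

/-- The cut-off function near infinity. -/
noncomputable def farCutoff (K : ℝ) (p : ℝ × ℝ) : ℝ :=
  Real.smoothTransition (K + 1 - (p.1 ^ 2 + p.2 ^ 2))

/-- The product of the cut-off functions near the axis and near infinity. -/
noncomputable def cutoff (K : ℝ) (p : ℝ × ℝ) : ℝ := axisCutoff K p * farCutoff K p

theorem contDiff_axisCutoff (K : ℝ) : ContDiff ℝ ∞ (axisCutoff K) :=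
  contDiff_smoothTransition.comp (by fun_prop)

theorem contDiff_farCutoff (K : ℝ) : ContDiff ℝ ∞ (farCutoff K) :=
  contDiff_smoothTransition.comp (by fun_prop)

theorem contDiff_cutoff (K : ℝ) : ContDiff ℝ ∞ (cutoff K) :=
  (contDiff_axisCutoff K).mul (contDiff_farCutoff K)

theorem cutoff_mem_Icc (K : ℝ) (p : ℝ × ℝ) : cutoff K p ∈ Icc (0 : ℝ) 1 :=
  ⟨mul_nonneg (Real.smoothTransition.nonneg _) (Real.smoothTransition.nonneg _),
    mul_le_one₀ (Real.smoothTransition.le_one _) (Real.smoothTransition.nonneg _)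
      (Real.smoothTransition.le_one _)⟩

theorem dr_affine (K c : ℝ) : dr (fun p => K * p.1 - c) = fun _ => K := by
  ext p
  have h : HasFDerivAt (fun p : ℝ × ℝ => K * p.1 - c) _ p :=
    ((hasFDerivAt_fst_real p).const_mul K).sub_const c
  unfold dr
  rw [h.fderiv]
  simp

theorem dz_affine (K c : ℝ) : dz (fun p => K * p.1 - c) = fun _ => 0 := by
  ext p
  have h : HasFDerivAt (fun p : ℝ × ℝ => K * p.1 - c) _ p :=
    ((hasFDerivAt_fst_real p).const_mul K).sub_const c
  unfold dz
  rw [h.fderiv]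
  simp

theorem dr_axisCutoff (K : ℝ) :
    dr (axisCutoff K) = fun p => deriv Real.smoothTransition (K * p.1 - 1) * K := by
  unfold axisCutoff
  rw [dr_comp (contDiff_smoothTransition.differentiable (by simp)) (by fun_prop), dr_affine]

theorem dz_axisCutoff (K : ℝ) : dz (axisCutoff K) = fun _ => 0 := by
  unfold axisCutoff
  rw [dz_comp (contDiff_smoothTransition.differentiable (by simp)) (by fun_prop), dz_affine]
  simp

theorem diffExpr_axisCutoff (K : ℝ) (p : ℝ × ℝ) : diffExpr (axisCutoff K) p =
    -(K ^ 2 * deriv (deriv Real.smoothTransition) (K * p.1 - 1)) +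
      (p.1 / 2 - 3 / p.1) * (K * deriv Real.smoothTransition (K * p.1 - 1)) := by
  have h2 : dr (fun p => deriv Real.smoothTransition (K * p.1 - 1) * K) p =
      deriv (deriv Real.smoothTransition) (K * p.1 - 1) * K * K := by
    have hG : ContDiff ℝ ∞ fun p : ℝ × ℝ => deriv Real.smoothTransition (K * p.1 - 1) :=
      contDiff_deriv_smoothTransition.comp (by fun_prop)
    rw [dr_mul hG contDiff_const,
      dr_comp (contDiff_deriv_smoothTransition.differentiable (by simp)) (by fun_prop), dr_affine]
    simp [dr]
  have h3 : dz (fun _ => 0) p = 0 := by simp [dz]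
  unfold diffExpr
  rw [dr_axisCutoff, dz_axisCutoff, h2, h3]
  ring

theorem dr_farArg (c : ℝ) : dr (fun p => c - (p.1 ^ 2 + p.2 ^ 2)) = fun p => -2 * p.1 := by
  ext p
  have h1 : HasFDerivAt (fun p : ℝ × ℝ => p.1 ^ 2) _ p := (hasFDerivAt_fst_real p).pow 2
  have h2 : HasFDerivAt (fun p : ℝ × ℝ => p.2 ^ 2) _ p := (hasFDerivAt_snd_real p).pow 2
  have h : HasFDerivAt (fun p : ℝ × ℝ => c - (p.1 ^ 2 + p.2 ^ 2)) _ p :=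
    (h1.fun_add h2).const_sub c
  unfold dr
  rw [h.fderiv]
  simp

theorem dz_farArg (c : ℝ) : dz (fun p => c - (p.1 ^ 2 + p.2 ^ 2)) = fun p => -2 * p.2 := by
  ext p
  have h1 : HasFDerivAt (fun p : ℝ × ℝ => p.1 ^ 2) _ p := (hasFDerivAt_fst_real p).pow 2
  have h2 : HasFDerivAt (fun p : ℝ × ℝ => p.2 ^ 2) _ p := (hasFDerivAt_snd_real p).pow 2
  have h : HasFDerivAt (fun p : ℝ × ℝ => c - (p.1 ^ 2 + p.2 ^ 2)) _ p :=
    (h1.fun_add h2).const_sub c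
  unfold dz
  rw [h.fderiv]
  simp

theorem dr_farCutoff (K : ℝ) : dr (farCutoff K) = fun p =>
    deriv Real.smoothTransition (K + 1 - (p.1 ^ 2 + p.2 ^ 2)) * (-2 * p.1) := by
  unfold farCutoff
  rw [dr_comp (contDiff_smoothTransition.differentiable (by simp)) (by fun_prop), dr_farArg]

theorem dz_farCutoff (K : ℝ) : dz (farCutoff K) = fun p =>
    deriv Real.smoothTransition (K + 1 - (p.1 ^ 2 + p.2 ^ 2)) * (-2 * p.2) := by
  unfold farCutoff
  rw [dz_comp (contDiff_smoothTransition.differentiable (by simp)) (by fun_prop), dz_farArg]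

/-- The radial derivative carries a factor `p.1` that cancels `3 / p.1`, so nothing is singular at
the axis. The constant 10 is 4 from the Laplacian plus 6 from the singular term. -/
theorem diffExpr_farCutoff (K : ℝ) {p : ℝ × ℝ} (hp : p.1 ≠ 0) : diffExpr (farCutoff K) p =
    -(4 * (p.1 ^ 2 + p.2 ^ 2)) *
        deriv (deriv Real.smoothTransition) (K + 1 - (p.1 ^ 2 + p.2 ^ 2)) +
      (10 - (p.1 ^ 2 + p.2 ^ 2)) * deriv Real.smoothTransition (K + 1 - (p.1 ^ 2 + p.2 ^ 2)) := by
  have hG : ContDiff ℝ ∞ fun p : ℝ × ℝ =>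
      deriv Real.smoothTransition (K + 1 - (p.1 ^ 2 + p.2 ^ 2)) :=
    contDiff_deriv_smoothTransition.comp (by fun_prop)
  have d1 : dr (fun p => -2 * p.1) p = -2 := by
    have := congrFun (dr_affine (-2) 0) p
    simpa only [sub_zero] using this
  have d2 : dz (fun p => -2 * p.2) p = -2 := by
    have h : HasFDerivAt (fun p : ℝ × ℝ => -2 * p.2) _ p := (hasFDerivAt_snd_real p).const_mul (-2)
    unfold dz
    rw [h.fderiv]
    simp
  have h2 : dr (fun p => deriv Real.smoothTransition (K + 1 - (p.1 ^ 2 + p.2 ^ 2)) * (-2 * p.1)) p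
      = deriv (deriv Real.smoothTransition) (K + 1 - (p.1 ^ 2 + p.2 ^ 2)) * (-2 * p.1) * (-2 * p.1)
        + deriv Real.smoothTransition (K + 1 - (p.1 ^ 2 + p.2 ^ 2)) * (-2) := by
    rw [dr_mul (g := fun p => -2 * p.1) hG (by fun_prop),
      dr_comp (contDiff_deriv_smoothTransition.differentiable (by simp)) (by fun_prop), dr_farArg]
    dsimp only
    rw [d1]
  have h3 : dz (fun p => deriv Real.smoothTransition (K + 1 - (p.1 ^ 2 + p.2 ^ 2)) * (-2 * p.2)) p
      = deriv (deriv Real.smoothTransition) (K + 1 - (p.1 ^ 2 + p.2 ^ 2)) * (-2 * p.2) * (-2 * p.2)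
        + deriv Real.smoothTransition (K + 1 - (p.1 ^ 2 + p.2 ^ 2)) * (-2) := by
    rw [dz_mul (g := fun p => -2 * p.2) hG (by fun_prop),
      dz_comp (contDiff_deriv_smoothTransition.differentiable (by simp)) (by fun_prop), dz_farArg]
    dsimp only
    rw [d2]
  unfold diffExpr
  rw [dr_farCutoff, dz_farCutoff, h2, h3]
  field_simp
  ring

theorem isTest_cutoff_mul {K : ℝ} (hK : 1 ≤ K) {P : ℝ × ℝ → ℝ} (hP : ContDiff ℝ ∞ P) :
    IsTest fun p => cutoff K p * P p := by
  have hK0 : 0 < K := by linarith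
  -- `axisCutoff` vanishes for `r ≤ 1/K`, and `farCutoff` for `r² + z² ≥ K + 1`.
  let S : Set (ℝ × ℝ) := {p | 1 / K ≤ p.1 ∧ p.1 ^ 2 + p.2 ^ 2 ≤ K + 1}
  have hSc : IsClosed S := by
    exact (isClosed_le continuous_const continuous_fst).inter
      (isClosed_le (by fun_prop : Continuous fun p : ℝ × ℝ => p.1 ^ 2 + p.2 ^ 2) continuous_const)
  have hS : IsCompact S := by
    refine Metric.isCompact_of_isClosed_isBounded hSc
      (((Metric.isBounded_Icc (-(K + 1)) (K + 1)).prod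
        (Metric.isBounded_Icc (-(K + 1)) (K + 1))).subset fun p hp => ?_)
    obtain ⟨-, hp⟩ := hp
    have h1 : |p.1| ≤ K + 1 := abs_le_of_sq_le_sq (by nlinarith [sq_nonneg p.2]) (by linarith)
    have h2 : |p.2| ≤ K + 1 := abs_le_of_sq_le_sq (by nlinarith [sq_nonneg p.1]) (by linarith)
    exact ⟨abs_le.mp h1, abs_le.mp h2⟩
  have hz : ∀ p ∉ S, cutoff K p * P p = 0 := fun p hp => by
    rcases not_and_or.mp hp with h | h
    · have : K * p.1 - 1 ≤ 0 := by
        rw [not_le, lt_div_iff₀ hK0] at h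
        linarith
      simp [cutoff, axisCutoff, Real.smoothTransition.zero_of_nonpos this]
    · have : K + 1 - (p.1 ^ 2 + p.2 ^ 2) ≤ 0 := by linarith
      simp [cutoff, farCutoff, Real.smoothTransition.zero_of_nonpos this]
  refine ⟨(contDiff_cutoff K).mul hP, HasCompactSupport.intro' hS hSc hz, ?_⟩
  have hsub : tsupport (fun p => cutoff K p * P p) ⊆ S :=
    closure_minimal (fun p hp => by
      by_contra h
      exact hp (hz p h)) hSc
  exact hsub.trans fun p hp => lt_of_lt_of_le (by positivity : 0 < 1 / K) hp.1

/-- `𝓛 (χ P) - χ 𝓛 P` for the cut-off function `χ`. -/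
noncomputable def cutoffError (K : ℝ) (P : ℝ × ℝ → ℝ) (p : ℝ × ℝ) : ℝ :=
  P p * diffExpr (cutoff K) p - 2 * (dr (cutoff K) p * dr P p + dz (cutoff K) p * dz P p)

theorem diffExpr_cutoff_mul (K : ℝ) {P : ℝ × ℝ → ℝ} (hP : ContDiff ℝ ∞ P) (p : ℝ × ℝ) :
    diffExpr (fun p => cutoff K p * P p) p = cutoff K p * diffExpr P p + cutoffError K P p := by
  rw [diffExpr_mul (contDiff_cutoff K) hP, cutoffError]
  ring

theorem dr_cutoff (K : ℝ) (p : ℝ × ℝ) : dr (cutoff K) p =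
    dr (axisCutoff K) p * farCutoff K p + axisCutoff K p * dr (farCutoff K) p :=
  congrFun (dr_mul (contDiff_axisCutoff K) (contDiff_farCutoff K)) p

theorem dz_cutoff (K : ℝ) (p : ℝ × ℝ) : dz (cutoff K) p = axisCutoff K p * dz (farCutoff K) p := by
  have := congrFun (dz_mul (contDiff_axisCutoff K) (contDiff_farCutoff K)) p
  rw [dz_axisCutoff, zero_mul, zero_add] at this
  exact this

theorem diffExpr_cutoff (K : ℝ) (p : ℝ × ℝ) : diffExpr (cutoff K) p =
    axisCutoff K p * diffExpr (farCutoff K) p + farCutoff K p * diffExpr (axisCutoff K) p -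
      2 * (dr (axisCutoff K) p * dr (farCutoff K) p) := by
  have := diffExpr_mul (contDiff_axisCutoff K) (contDiff_farCutoff K) p
  rw [dz_axisCutoff, zero_mul, add_zero] at this
  exact this

/-- For large `K` both transition arguments exceed 1 at `p`, so the cut-off is constant near `p`. -/
theorem cutoffError_eventually_eq_zero (P : ℝ × ℝ → ℝ) {p : ℝ × ℝ} (hp : p ∈ halfPlane) :
    ∀ᶠ K : ℝ in atTop, cutoffError K P p = 0 := by
  have hp0 : 0 < p.1 := hp
  filter_upwards [eventually_gt_atTop (2 / p.1), eventually_gt_atTop (p.1 ^ 2 + p.2 ^ 2)]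
    with K h1 h2
  rw [div_lt_iff₀ hp0] at h1
  have n1 : K * p.1 - 1 ∉ Icc (0 : ℝ) 1 := fun h => by linarith [h.2]
  have n2 : K + 1 - (p.1 ^ 2 + p.2 ^ 2) ∉ Icc (0 : ℝ) 1 := fun h => by linarith [h.2]
  have z1 := deriv_smoothTransition_eq_zero n1
  have z2 := deriv_smoothTransition_eq_zero n2
  simp [cutoffError, diffExpr_cutoff, dr_cutoff, dz_cutoff, diffExpr_axisCutoff,
    diffExpr_farCutoff K hp0.ne', dr_axisCutoff, dr_farCutoff, dz_farCutoff, z1.1, z1.2, z2.1, z2.2]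

/-- Derivatives of the axis cut-off live on `1 ≤ K r ≤ 2`. There `1/r ≤ K`, so the singular term `K
· 3/r` is of the same order `K²` as the second derivative. The far cut-off contributes `O(1 + r² +
z²)` uniformly in `K`. -/
theorem exists_bound_cutoff : ∃ D : ℝ, 0 ≤ D ∧ ∀ K : ℝ, 1 ≤ K → ∀ p ∈ halfPlane,
    ∀ X, X = D * (1 + (p.1 ^ 2 + p.2 ^ 2)) * (1 + if K * p.1 ≤ 2 then K ^ 2 else 0) →
      |dr (cutoff K) p| ≤ X ∧ |dz (cutoff K) p| ≤ X ∧ |diffExpr (cutoff K) p| ≤ 20 * X := by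
  obtain ⟨C, hC1, hC⟩ := exists_bound_deriv_smoothTransition
  have hC0 : 0 ≤ C := by linarith
  refine ⟨C ^ 2, by positivity, fun K hK p hp X hX => ?_⟩
  have hp0 : 0 < p.1 := hp
  set I : ℝ := if K * p.1 ≤ 2 then K ^ 2 else 0 with hI
  have hI0 : 0 ≤ I := by rw [hI]; split_ifs <;> positivity
  set q : ℝ := 1 + (p.1 ^ 2 + p.2 ^ 2) with hq
  have hq1 : 1 ≤ q := by rw [hq]; nlinarith [sq_nonneg p.1, sq_nonneg p.2]
  have hq0 : 0 ≤ q := by linarith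
  have hCC : C ≤ C ^ 2 := by nlinarith
  have hg : ∀ x, |Real.smoothTransition x| ≤ 1 := fun x => by
    rw [abs_of_nonneg (Real.smoothTransition.nonneg x)]
    exact Real.smoothTransition.le_one x
  have ha : |axisCutoff K p| ≤ 1 := hg _
  have hb : |farCutoff K p| ≤ 1 := hg _
  obtain ⟨b1, b2⟩ := hC (K + 1 - (p.1 ^ 2 + p.2 ^ 2))
  obtain ⟨a1, a2⟩ := hC (K * p.1 - 1)
  have hbr : |dr (farCutoff K) p| ≤ C * q := by
    rw [dr_farCutoff]
    simp only [abs_mul, abs_neg, abs_two]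
    refine mul_le_mul b1 ?_ (by positivity) hC0
    rw [hq]
    nlinarith [sq_nonneg (|p.1| - 1), sq_abs p.1, sq_nonneg p.2]
  have hbz : |dz (farCutoff K) p| ≤ C * q := by
    rw [dz_farCutoff]
    simp only [abs_mul, abs_neg, abs_two]
    refine mul_le_mul b1 ?_ (by positivity) hC0
    rw [hq]
    nlinarith [sq_nonneg (|p.2| - 1), sq_abs p.2, sq_nonneg p.1]
  have hbL : |diffExpr (farCutoff K) p| ≤ 15 * C * q := by
    rw [diffExpr_farCutoff K hp0.ne']
    refine (abs_add_le _ _).trans ?_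
    rw [abs_mul, abs_mul]
    have e1 : |-(4 * (p.1 ^ 2 + p.2 ^ 2))| ≤ 4 * q := by
      rw [abs_neg, abs_of_nonneg (by positivity), hq]; linarith
    have e2 : |10 - (p.1 ^ 2 + p.2 ^ 2)| ≤ 11 * q := by
      rw [abs_le, hq]
      constructor <;> nlinarith [sq_nonneg p.1, sq_nonneg p.2]
    have := mul_le_mul e1 b2 (abs_nonneg _) (by positivity)
    have := mul_le_mul e2 b1 (abs_nonneg _) (by positivity)
    linarith
  have hax : |dr (axisCutoff K) p| ≤ C * I ∧ |diffExpr (axisCutoff K) p| ≤ 5 * C * I := by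
    rw [dr_axisCutoff, diffExpr_axisCutoff]
    dsimp only
    by_cases hx : K * p.1 - 1 ∈ Icc (0 : ℝ) 1
    · have h1 : 1 ≤ K * p.1 := by linarith [hx.1]
      have h2 : K * p.1 ≤ 2 := by linarith [hx.2]
      rw [hI, if_pos h2]
      have hKK : K ≤ K ^ 2 := by nlinarith
      constructor
      · rw [abs_mul, abs_of_nonneg (by linarith : 0 ≤ K)]
        exact mul_le_mul a1 hKK (by linarith) hC0
      · have h3 : 3 / p.1 ≤ 3 * K := by
          rw [div_le_iff₀ hp0]; linarith
        have h4 : p.1 ≤ 2 := by nlinarith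
        -- Uses `r/2 ≤ 1 ≤ K` and `3/r ≤ 3K`.
        have h5 : |p.1 / 2 - 3 / p.1| ≤ 4 * K := by
          have : 0 < 3 / p.1 := by positivity
          rw [abs_le]; constructor <;> linarith
        refine (abs_add_le _ _).trans ?_
        rw [abs_neg, abs_mul, abs_mul, abs_mul, abs_of_nonneg (by positivity : 0 ≤ K ^ 2),
          abs_of_nonneg (by linarith : 0 ≤ K)]
        have e1 := mul_le_mul_of_nonneg_left a2 (by positivity : 0 ≤ K ^ 2)
        have e2 := mul_le_mul h5 (mul_le_mul_of_nonneg_left a1 (by linarith : 0 ≤ K))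
          (by positivity) (by positivity)
        nlinarith
    · rw [(deriv_smoothTransition_eq_zero hx).1, (deriv_smoothTransition_eq_zero hx).2]
      simp only [mul_zero, zero_mul, neg_zero, add_zero, abs_zero]
      exact ⟨by positivity, by positivity⟩
  obtain ⟨har, haL⟩ := hax
  have hL : |diffExpr (cutoff K) p| ≤ 20 * C ^ 2 * q * (1 + I) := by
    rw [diffExpr_cutoff]
    have t1 : |axisCutoff K p * diffExpr (farCutoff K) p| ≤ 1 * (15 * C * q) := by
      rw [abs_mul]; exact mul_le_mul ha hbL (abs_nonneg _) zero_le_one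
    have t2 : |farCutoff K p * diffExpr (axisCutoff K) p| ≤ 1 * (5 * C * I) := by
      rw [abs_mul]; exact mul_le_mul hb haL (abs_nonneg _) zero_le_one
    have t3 : |2 * (dr (axisCutoff K) p * dr (farCutoff K) p)| ≤ 2 * (C * I * (C * q)) := by
      rw [abs_mul, abs_mul, abs_two]
      exact mul_le_mul_of_nonneg_left (mul_le_mul har hbr (abs_nonneg _) (by positivity)) zero_le_two
    refine (abs_sub _ _).trans ?_
    have t4 := abs_add_le (axisCutoff K p * diffExpr (farCutoff K) p)
      (farCutoff K p * diffExpr (axisCutoff K) p)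
    have u1 : C * q ≤ C ^ 2 * q := mul_le_mul_of_nonneg_right hCC hq0
    have u2 : C * I ≤ C ^ 2 * (q * I) := by
      have : I ≤ q * I := le_mul_of_one_le_left hI0 hq1
      exact mul_le_mul hCC this hI0 (by positivity)
    have u3 : 0 ≤ C ^ 2 * (q * I) := by positivity
    have u4 : 0 ≤ C ^ 2 * q := by positivity
    linarith
  have hr : |dr (cutoff K) p| ≤ C ^ 2 * q * (1 + I) := by
    rw [dr_cutoff]
    refine (abs_add_le _ _).trans ?_
    rw [abs_mul, abs_mul]
    have t1 := mul_le_mul har hb (abs_nonneg _) (by positivity)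
    have t2 := mul_le_mul ha hbr (abs_nonneg _) zero_le_one
    have u1 : C * q ≤ C ^ 2 * q := mul_le_mul_of_nonneg_right hCC hq0
    have u2 : C * I ≤ C ^ 2 * (q * I) := by
      have : I ≤ q * I := le_mul_of_one_le_left hI0 hq1
      exact mul_le_mul hCC this hI0 (by positivity)
    linarith
  have hz : |dz (cutoff K) p| ≤ C ^ 2 * q * (1 + I) := by
    rw [dz_cutoff, abs_mul]
    have t2 := mul_le_mul ha hbz (abs_nonneg _) zero_le_one
    have u1 : C * q ≤ C ^ 2 * q := mul_le_mul_of_nonneg_right hCC hq0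
    have u3 : 0 ≤ C ^ 2 * (q * I) := by positivity
    linarith
  rw [hX]
  exact ⟨hr, hz, hL.trans_eq (by ring)⟩

/-! ### Uniform `L²` bounds for the cut-off error -/

theorem abs_cutoffError_le : ∃ D : ℝ, 0 ≤ D ∧ ∀ K : ℝ, 1 ≤ K → ∀ (P : ℝ × ℝ → ℝ),
    ∀ p ∈ halfPlane, |cutoffError K P p| ≤
      D * (1 + (p.1 ^ 2 + p.2 ^ 2)) * (|P p| + ‖fderiv ℝ P p‖) *
        (1 + if K * p.1 ≤ 2 then K ^ 2 else 0) := by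
  obtain ⟨D, hD, h⟩ := exists_bound_cutoff
  refine ⟨20 * D, by positivity, fun K hK P p hp => ?_⟩
  obtain ⟨X, hX⟩ : ∃ X, X = D * (1 + (p.1 ^ 2 + p.2 ^ 2)) *
    (1 + if K * p.1 ≤ 2 then K ^ 2 else 0) := ⟨_, rfl⟩
  obtain ⟨hr, hz, hL⟩ := h K hK p hp X hX
  have hX0 : 0 ≤ X := (abs_nonneg _).trans hr
  have hPr : |dr P p| ≤ ‖fderiv ℝ P p‖ := by
    have := (fderiv ℝ P p).le_opNorm (1, 0)
    simpa [dr, Prod.norm_def] using this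
  have hPz : |dz P p| ≤ ‖fderiv ℝ P p‖ := by
    have := (fderiv ℝ P p).le_opNorm (0, 1)
    simpa [dz, Prod.norm_def] using this
  unfold cutoffError
  have s1 : |P p * diffExpr (cutoff K) p| ≤ |P p| * (20 * X) := by
    rw [abs_mul]
    exact mul_le_mul_of_nonneg_left hL (abs_nonneg _)
  have s2 : |dr (cutoff K) p * dr P p| ≤ X * ‖fderiv ℝ P p‖ := by
    rw [abs_mul]; exact mul_le_mul hr hPr (abs_nonneg _) hX0
  have s3 : |dz (cutoff K) p * dz P p| ≤ X * ‖fderiv ℝ P p‖ := by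
    rw [abs_mul]; exact mul_le_mul hz hPz (abs_nonneg _) hX0
  refine (abs_sub _ _).trans ?_
  rw [abs_mul 2, abs_two]
  have s4 := abs_add_le (dr (cutoff K) p * dr P p) (dz (cutoff K) p * dz P p)
  have s5 : 0 ≤ X * ‖fderiv ℝ P p‖ := by positivity
  calc _ ≤ 20 * (X * |P p|) + 20 * (X * ‖fderiv ℝ P p‖) := by linarith
    _ = _ := by rw [hX]; ring

theorem exists_abs_cutoffError_le {P : ℝ × ℝ → ℝ} (hP : P.HasTemperateGrowth) :
    ∃ D : ℝ, 0 ≤ D ∧ ∀ K : ℝ, 1 ≤ K → ∀ p ∈ halfPlane, |cutoffError K P p| ≤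
      D * Real.exp (1 / 16 * (p.1 ^ 2 + p.2 ^ 2)) * (1 + if K * p.1 ≤ 2 then K ^ 2 else 0) := by
  obtain ⟨D, hD, h⟩ := abs_cutoffError_le
  have h1 := hasTemperateGrowth_fst
  have h2 := hasTemperateGrowth_snd
  -- Two factors of exponent 1/32 give 1/16; its square has exponent 1/8, below the threshold 1/4.
  have hq : GaussBound (1 / 32) fun p : ℝ × ℝ => 1 + (p.1 ^ 2 + p.2 ^ 2) :=
    Function.HasTemperateGrowth.gaussBound (by fun_prop) (by norm_num)
  obtain ⟨A, hA⟩ := hP.gaussBound (c := 1 / 32) (by norm_num)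
  obtain ⟨B, hB⟩ := hP.gaussBound_fderiv (c := 1 / 32) (by norm_num)
  have hs : GaussBound (1 / 32) fun p : ℝ × ℝ => |P p| + ‖fderiv ℝ P p‖ := by
    refine ⟨A + B, fun p => ?_⟩
    rw [Real.norm_of_nonneg (by positivity), add_mul]
    exact add_le_add (hA p) (hB p)
  obtain ⟨E, hE⟩ := hq.mul hs
  have hE0 : 0 ≤ E := by
    have := (norm_nonneg _).trans (hE 0)
    simpa using this
  refine ⟨D * E, by positivity, fun K hK p hp => (h K hK P p hp).trans ?_⟩
  have := (le_abs_self _).trans (hE p)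
  norm_num at this
  rw [mul_assoc D, mul_assoc D E]
  gcongr

/-- The critical estimate: near the axis `K⁴ r³ = K (K r)³ ≤ 8 K` on an interval of length `2/K`,
which contributes at most 16 for every `K`. A weight of lower power would let this diverge. -/
theorem exists_integral_cutoffError_sq_le {P : ℝ × ℝ → ℝ} (hP : P.HasTemperateGrowth) :
    ∃ M : ℝ, ∀ K : ℝ, 1 ≤ K → ∫ p, cutoffError K P p ^ 2 ∂mu ≤ M := by
  obtain ⟨D, hD, h⟩ := exists_abs_cutoffError_le hP
  set J : ℝ := ∫ z, Real.exp (-z ^ 2 / 4) * Real.exp (1 / 8 * z ^ 2) with hJ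
  have hJ0 : 0 ≤ J := integral_nonneg fun z => by positivity
  refine ⟨2 * D ^ 2 * ((∫ p, Real.exp (1 / 8 * (p.1 ^ 2 + p.2 ^ 2)) ∂mu) +
    1 / (16 * √Real.pi) * (16 * J)), fun K hK => ?_⟩
  have hK0 : 0 < K := by linarith
  set u : ℝ → ℝ := fun r => Real.exp (1 / 8 * r ^ 2) * if K * r ≤ 2 then K ^ 4 else 0 with hu
  set v : ℝ → ℝ := fun z => Real.exp (1 / 8 * z ^ 2) with hv
  have i1 : Integrable (fun p : ℝ × ℝ => Real.exp (1 / 8 * (p.1 ^ 2 + p.2 ^ 2))) mu :=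
    integrable_mu_exp (by norm_num)
  have hmeas : Measurable u := by
    refine Measurable.mul (by fun_prop) (Measurable.ite ?_ measurable_const measurable_const)
    exact measurableSet_le (by fun_prop) measurable_const
  have i2 : Integrable (fun p : ℝ × ℝ => u p.1 * v p.2) mu := by
    refine (i1.const_mul (K ^ 4)).mono' ?_ (.of_forall fun p => ?_)
    · exact ((hmeas.comp measurable_fst).mul
        ((by fun_prop : Measurable v).comp measurable_snd)).aestronglyMeasurable
    · rw [mul_add, Real.exp_add, hu, hv]
      dsimp only
      split_ifs
      · rw [Real.norm_of_nonneg (by positivity)]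
        exact le_of_eq (by ring)
      · simp only [mul_zero, zero_mul, norm_zero]
        positivity
  have hle : ∀ᵐ p ∂mu, cutoffError K P p ^ 2 ≤
      2 * D ^ 2 * (Real.exp (1 / 8 * (p.1 ^ 2 + p.2 ^ 2)) + u p.1 * v p.2) := by
    filter_upwards [ae_mem_halfPlane] with p hp
    have h1 := pow_le_pow_left₀ (abs_nonneg _) (h K hK p hp) 2
    rw [sq_abs] at h1
    refine h1.trans ?_
    set e := Real.exp (1 / 16 * (p.1 ^ 2 + p.2 ^ 2)) with he
    have e2 : e ^ 2 = Real.exp (1 / 8 * (p.1 ^ 2 + p.2 ^ 2)) := by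
      rw [he, ← Real.exp_nat_mul]; ring_nf
    have e3 : u p.1 * v p.2 = e ^ 2 * (if K * p.1 ≤ 2 then K ^ 2 else 0) ^ 2 := by
      rw [e2, mul_add, Real.exp_add, hu, hv]
      dsimp only
      split_ifs <;> ring
    rw [← e2, e3]
    set I : ℝ := if K * p.1 ≤ 2 then K ^ 2 else 0
    -- This is `(1 + I)² ≤ 2 (1 + I²)`.
    have : 0 ≤ (D * e) ^ 2 * (1 - I) ^ 2 := by positivity
    nlinarith
  have hint : ∫ p, u p.1 * v p.2 ∂mu ≤ 1 / (16 * √Real.pi) * (16 * J) := by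
    rw [integral_mu_prod]
    gcongr
    have hb : ∀ r ∈ Ioi (0 : ℝ), r ^ 3 * Real.exp (-r ^ 2 / 4) * u r ≤
        (Ioc (0 : ℝ) (2 / K)).indicator (fun _ => 8 * K) r := fun r hr => by
      have hr0 : 0 < r := hr
      rw [hu]
      dsimp only
      by_cases hc : K * r ≤ 2
      · have hm : r ∈ Ioc (0 : ℝ) (2 / K) := ⟨hr0, by rw [le_div_iff₀ hK0]; linarith⟩
        rw [if_pos hc, indicator_of_mem hm]
        have e1 : r ^ 3 * Real.exp (-r ^ 2 / 4) * (Real.exp (1 / 8 * r ^ 2) * K ^ 4) =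
            K * (K * r) ^ 3 * Real.exp (-r ^ 2 / 8) := by
          rw [show -r ^ 2 / 8 = -r ^ 2 / 4 + 1 / 8 * r ^ 2 by ring, Real.exp_add]
          ring
        rw [e1]
        have e2 : (K * r) ^ 3 ≤ 2 ^ 3 := pow_le_pow_left₀ (by positivity) hc 3
        have e3 : Real.exp (-r ^ 2 / 8) ≤ 1 := Real.exp_le_one_iff.mpr (by nlinarith)
        calc K * (K * r) ^ 3 * Real.exp (-r ^ 2 / 8) ≤ K * 2 ^ 3 * 1 := by gcongr
          _ = 8 * K := by ring
      · rw [if_neg hc]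
        simp only [mul_zero]
        exact indicator_nonneg (fun _ _ => by positivity) r
    have hii : IntegrableOn ((Ioc (0 : ℝ) (2 / K)).indicator fun _ => 8 * K) (Ioi 0) :=
      ((integrable_indicator_iff measurableSet_Ioc).mpr
        (integrableOn_const (by simp))).integrableOn
    calc ∫ r in Ioi 0, r ^ 3 * Real.exp (-r ^ 2 / 4) * u r
        ≤ ∫ r in Ioi 0, (Ioc (0 : ℝ) (2 / K)).indicator (fun _ => 8 * K) r := by
          refine integral_mono_of_nonneg ?_ hii ?_
          · refine (ae_restrict_iff' measurableSet_Ioi).mpr (.of_forall fun r hr => ?_)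
            have hr0 : 0 < r := hr
            rw [hu]
            dsimp only [Pi.zero_apply]
            split_ifs <;> positivity
          · exact (ae_restrict_iff' measurableSet_Ioi).mpr (.of_forall hb)
      _ = 16 := by
          rw [setIntegral_indicator measurableSet_Ioc, inter_eq_right.mpr Ioc_subset_Ioi_self,
            setIntegral_const]
          simp [Real.volume_real_Ioc_of_le (by positivity : (0 : ℝ) ≤ 2 / K)]
          field_simp
          norm_num
  calc ∫ p, cutoffError K P p ^ 2 ∂mu
      ≤ ∫ p, 2 * D ^ 2 * (Real.exp (1 / 8 * (p.1 ^ 2 + p.2 ^ 2)) + u p.1 * v p.2) ∂mu :=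
        integral_mono_of_nonneg (.of_forall fun p => sq_nonneg _)
          ((i1.add i2).const_mul (2 * D ^ 2)) hle
    _ = 2 * D ^ 2 * ((∫ p, Real.exp (1 / 8 * (p.1 ^ 2 + p.2 ^ 2)) ∂mu) +
          ∫ p, u p.1 * v p.2 ∂mu) := by
        rw [integral_const_mul, integral_add i1 i2]
    _ ≤ _ := by gcongr

/-- Functions that are bounded in `L²` and eventually vanish at almost every point converge weakly
to zero in `L²`. -/
theorem tendsto_integral_smul_of_bounded {α F : Type*} [MeasurableSpace α] {μ : Measure α}
    [NormedAddCommGroup F] [NormedSpace ℝ F] {h : ℕ → α → ℝ} {f : α → F} {M : ℝ}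
    (hh : ∀ k, MemLp (h k) 2 μ) (hM : ∀ k, ∫ x, h k x ^ 2 ∂μ ≤ M)
    (h0 : ∀ᵐ x ∂μ, ∀ᶠ k in atTop, h k x = 0) (hf : MemLp f 2 μ) :
    Tendsto (fun k => ∫ x, h k x • f x ∂μ) atTop (𝓝 0) := by
  have hM0 : 0 ≤ M := (integral_nonneg fun x => sq_nonneg _).trans (hM 0)
  have hf2 : Integrable (fun x => ‖f x‖ ^ 2) μ := (memLp_two_iff_integrable_sq_norm hf.1).mp hf
  have hg : ∀ k, AEStronglyMeasurable (fun x => if h k x = 0 then 0 else ‖f x‖ ^ 2) μ := fun k => by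
    have h1 := (hh k).1
    have h2 : AEStronglyMeasurable (fun x => if h1.mk (h k) x = 0 then 0 else ‖f x‖ ^ 2) μ := by
      have hs : MeasurableSet {x | h1.mk (h k) x = 0} :=
        h1.stronglyMeasurable_mk.measurable (measurableSet_singleton 0)
      have := (hf2.1.indicator hs.compl)
      refine this.congr (.of_forall fun x => ?_)
      by_cases hx : h1.mk (h k) x = 0 <;> simp [indicator, hx]
    refine h2.congr ?_
    filter_upwards [h1.ae_eq_mk] with x hx
    rw [hx]
  -- The mass of `‖f‖²` on the set where `h k ≠ 0` tends to zero by dominated convergence.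
  have hlim : Tendsto (fun k => ∫ x, (if h k x = 0 then 0 else ‖f x‖ ^ 2) ∂μ) atTop (𝓝 0) := by
    rw [show 𝓝 (0 : ℝ) = 𝓝 (∫ _, (0 : ℝ) ∂μ) by simp]
    refine tendsto_integral_of_dominated_convergence (fun x => ‖f x‖ ^ 2) hg hf2
      (fun k => .of_forall fun x => ?_) ?_
    · split_ifs
      · simp
      · simp
    · filter_upwards [h0] with x hx
      refine tendsto_const_nhds.congr' ?_
      filter_upwards [hx] with k hk
      rw [if_pos hk]
  rw [Metric.tendsto_atTop] at hlim ⊢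
  intro ε hε
  -- Weight for Young's inequality: the `h k ^ 2` part and the `‖f‖²` part each contribute at most
  -- `ε/2`. The `+ 1` covers `M = 0`.
  set δ : ℝ := ε / (M + 1) with hδ
  have hδ0 : 0 < δ := by positivity
  obtain ⟨N, hN⟩ := hlim (ε * δ) (by positivity)
  refine ⟨N, fun k hk => ?_⟩
  have h1 := hN k hk
  have hgi : Integrable (fun x => if h k x = 0 then 0 else ‖f x‖ ^ 2) μ :=
    hf2.mono' (hg k) (.of_forall fun x => by split_ifs <;> simp)
  have hhi : Integrable (fun x => h k x ^ 2) μ := (hh k).integrable_sq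
  rw [dist_zero_right, Real.norm_of_nonneg
    (integral_nonneg fun x => by dsimp only [Pi.zero_apply]; split_ifs <;> positivity)] at h1
  rw [dist_zero_right]
  have hb : ∀ x, ‖h k x • f x‖ ≤
      δ / 2 * h k x ^ 2 + 1 / (2 * δ) * (if h k x = 0 then 0 else ‖f x‖ ^ 2) := fun x => by
    rw [norm_smul, Real.norm_eq_abs]
    split_ifs with hx
    · simp [hx]
    · have h2 : 0 ≤ 1 / (2 * δ) * (δ * |h k x| - ‖f x‖) ^ 2 := by positivity
      have h3 : 1 / (2 * δ) * (δ * |h k x| - ‖f x‖) ^ 2 =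
          δ / 2 * h k x ^ 2 + 1 / (2 * δ) * ‖f x‖ ^ 2 - |h k x| * ‖f x‖ := by
        rw [← sq_abs (h k x)]
        field_simp
        ring
      linarith
  calc ‖∫ x, h k x • f x ∂μ‖
      ≤ ∫ x, δ / 2 * h k x ^ 2 + 1 / (2 * δ) * (if h k x = 0 then 0 else ‖f x‖ ^ 2) ∂μ :=
        norm_integral_le_of_norm_le ((hhi.const_mul _).add (hgi.const_mul _)) (.of_forall hb)
    _ = δ / 2 * (∫ x, h k x ^ 2 ∂μ) +
          1 / (2 * δ) * ∫ x, (if h k x = 0 then 0 else ‖f x‖ ^ 2) ∂μ := by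
        rw [integral_add (hhi.const_mul _) (hgi.const_mul _), integral_const_mul,
          integral_const_mul]
    _ < δ / 2 * (M + 1) + 1 / (2 * δ) * (ε * δ) := by
        refine add_lt_add_of_le_of_lt ?_ ?_
        · have := hM k
          gcongr
          linarith
        · gcongr
    _ = ε := by
        rw [hδ]
        field_simp
        ring

/-! ### Testing the weak equation with eigenfunctions -/

variable {𝕜 : Type*} [RCLike 𝕜]

theorem integrable_smul_of_memLp {u : ℝ × ℝ → ℝ} (hu : MemLp u 2 mu) (f : Lp 𝕜 2 mu) :
    Integrable (fun p => u p • f p) mu := by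
  have := (Lp.memLp f).integrable_mul hu.ofReal (𝕜 := 𝕜)
  refine this.congr (.of_forall fun p => ?_)
  simp [RCLike.real_smul_eq_coe_mul, mul_comm]

theorem tendsto_integral_cutoff {u : ℝ × ℝ → ℝ} (hu : MemLp u 2 mu) (f : Lp 𝕜 2 mu) :
    Tendsto (fun k : ℕ => ∫ p, (cutoff (k + 1) p * u p) • f p ∂mu) atTop
      (𝓝 (∫ p, u p • f p ∂mu)) := by
  have hi := integrable_smul_of_memLp hu f
  refine tendsto_integral_of_dominated_convergence (fun p => ‖u p • f p‖) (fun k => ?_) hi.norm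
    (fun k => .of_forall fun p => ?_) ?_
  · exact (((contDiff_cutoff _).continuous.aestronglyMeasurable).mul hu.1).smul
      (Lp.aestronglyMeasurable f)
  · rw [mul_smul, norm_smul]
    obtain ⟨h1, h2⟩ := cutoff_mem_Icc (k + 1) p
    rw [Real.norm_of_nonneg h1]
    exact mul_le_of_le_one_left (norm_nonneg _) h2
  · filter_upwards [ae_mem_halfPlane] with p hp
    have hp0 : 0 < p.1 := hp
    refine tendsto_const_nhds.congr' ?_
    have ht : Tendsto (fun k : ℕ => (k : ℝ) + 1) atTop atTop :=
      tendsto_atTop_add_const_right _ _ tendsto_natCast_atTop_atTop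
    filter_upwards [ht.eventually_gt_atTop (2 / p.1), ht.eventually_gt_atTop (p.1 ^ 2 + p.2 ^ 2)]
      with k h1 h2
    rw [div_lt_iff₀ hp0] at h1
    rw [cutoff, axisCutoff, farCutoff, Real.smoothTransition.one_of_one_le (by linarith),
      Real.smoothTransition.one_of_one_le (by linarith)]
    simp

/-- Eigenfunctions may be used as test functions. -/
theorem inner_eigenfun_of_mem_opGraph {x : Lp 𝕜 2 mu × Lp 𝕜 2 mu} (hx : x ∈ opGraph 𝕜)
    (ℓ n : ℕ) :
    inner 𝕜 (toL2 𝕜 _ (memLp_eigenfun ℓ n)) x.2 =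
      (eigenval ℓ n : 𝕜) * inner 𝕜 (toL2 𝕜 _ (memLp_eigenfun ℓ n)) x.1 := by
  set P := eigenfun ℓ n with hP
  set c := eigenval ℓ n with hc
  have hPs : ContDiff ℝ ∞ P := contDiff_eigenfun ℓ n
  have hPm : MemLp P 2 mu := memLp_eigenfun ℓ n
  have hK : ∀ k : ℕ, (1 : ℝ) ≤ k + 1 := fun k => by linarith [(Nat.cast_nonneg k : (0 : ℝ) ≤ k)]
  have hT := fun k : ℕ => isTest_cutoff_mul (hK k) hPs
  have hcm : ∀ k : ℕ, MemLp (fun p => cutoff (k + 1) p * P p) 2 mu := fun k => (hT k).memLp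
  -- By the eigenvalue equation, `h k` is the cut-off error on the half-plane. Defined as a
  -- difference involving a test function, it is visibly in `L²`.
  set h : ℕ → ℝ × ℝ → ℝ := fun k p => diffExpr (fun p => cutoff (k + 1) p * P p) p -
    c * (cutoff (k + 1) p * P p) with hh
  have hhm : ∀ k, MemLp (h k) 2 mu := fun k => (hT k).memLp_diffExpr.sub ((hcm k).const_mul c)
  have he : ∀ k, ∀ p ∈ halfPlane, h k p = cutoffError (k + 1) P p := fun k p hp => by
    rw [hh]
    dsimp only
    rw [diffExpr_cutoff_mul _ hPs, hP, diffExpr_eigenfun ℓ n p hp]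
    ring
  obtain ⟨M, hM⟩ := exists_integral_cutoffError_sq_le (hasTemperateGrowth_eigenfun ℓ n)
  have hlim : Tendsto (fun k => ∫ p, h k p • x.1 p ∂mu) atTop (𝓝 0) := by
    refine tendsto_integral_smul_of_bounded hhm (M := M) (fun k => ?_) ?_ (Lp.memLp x.1)
    · refine (integral_congr_ae ?_).trans_le (hM (k + 1) (hK k))
      filter_upwards [ae_mem_halfPlane] with p hp
      rw [he k p hp]
    · filter_upwards [ae_mem_halfPlane] with p hp
      have ht : Tendsto (fun k : ℕ => (k : ℝ) + 1) atTop atTop :=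
        tendsto_atTop_add_const_right _ _ tendsto_natCast_atTop_atTop
      filter_upwards [ht.eventually (cutoffError_eventually_eq_zero P hp)] with k hk
      rw [he k p hp, hk]
  have h1 := tendsto_integral_cutoff hPm x.2
  have h2 := tendsto_integral_cutoff hPm x.1
  have h3 := hlim.add (h2.const_mul (c : 𝕜))
  rw [inner_toL2, inner_toL2]
  rw [zero_add] at h3
  refine tendsto_nhds_unique h1 (h3.congr fun k => ?_)
  rw [← hx _ (hT k), ← integral_const_mul, ← integral_add (integrable_smul_of_memLp (hhm k) x.1)
    ((integrable_smul_of_memLp (hcm k) x.1).const_mul _)]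
  refine integral_congr_ae (.of_forall fun p => ?_)
  simp only [hh, RCLike.real_smul_eq_coe_mul]
  push_cast
  ring

/-! ### Completeness of the polynomials -/

/-- The exponential series may be integrated term by term, with `‖F‖ exp ‖X‖` as the dominating sum.
-/
theorem integral_mul_cexp_eq_zero {α : Type*} [MeasurableSpace α] {μ : Measure α} {F X : α → ℂ}
    (hF : AEStronglyMeasurable F μ) (hX : AEStronglyMeasurable X μ)
    (hi : Integrable (fun x => ‖F x‖ * Real.exp ‖X x‖) μ)
    (h0 : ∀ j : ℕ, ∫ x, F x * X x ^ j ∂μ = 0) : ∫ x, F x * Complex.exp (X x) ∂μ = 0 := by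
  have hs : ∀ x, HasSum (fun j : ℕ => ‖F x‖ * (‖X x‖ ^ j / (j.factorial : ℝ)))
      (‖F x‖ * Real.exp ‖X x‖) := fun x => by
    have := NormedSpace.expSeries_div_hasSum_exp (‖X x‖ : ℝ)
    rw [← Real.exp_eq_exp_ℝ] at this
    exact this.mul_left _
  have h := hasSum_integral_of_dominated_convergence (μ := μ)
    (F := fun (j : ℕ) x => F x * (X x ^ j / (j.factorial : ℂ)))
    (f := fun x => F x * Complex.exp (X x))
    (fun j x => ‖F x‖ * (‖X x‖ ^ j / (j.factorial : ℝ)))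
    (fun j => hF.mul
      ((continuous_id.div_const (j.factorial : ℂ)).comp_aestronglyMeasurable (hX.pow j)))
    (fun j => .of_forall fun x => by simp)
    (.of_forall fun x => (hs x).summable)
    (hi.congr (.of_forall fun x => (hs x).tsum_eq.symm))
    (.of_forall fun x => by
      have := NormedSpace.expSeries_div_hasSum_exp (X x)
      rw [← Complex.exp_eq_exp_ℂ] at this
      exact this.mul_left _)
  refine h.unique ?_
  have : ∀ j : ℕ, ∫ x, F x * (X x ^ j / (j.factorial : ℂ)) ∂μ = 0 := fun j => by
    simp only [← mul_div_assoc]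
    rw [integral_div, h0, zero_div]
  simp only [this]
  exact hasSum_zero

section Completeness

variable {f : ℝ × ℝ → ℝ} (hf : MemLp f 2 mu)
  (h0 : ∀ P Q : Polynomial ℝ, ∫ p, polyFun P Q p * f p ∂mu = 0)

include hf in
theorem integrable_mul_norm_of_gaussBound {c : ℝ} (hc : c < 1 / 8) {u : ℝ × ℝ → ℝ}
    (hu : Continuous u) (hb : GaussBound c u) : Integrable (fun p => u p * f p) mu :=
  (hb.memLp hc hu.aestronglyMeasurable).integrable_mul hf

theorem gaussBound_pow (a : ℕ) : GaussBound (1 / 64) fun p : ℝ × ℝ => (p.1 ^ 2 / 4) ^ a := by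
  have := (hasTemperateGrowth_polyFun (Polynomial.X ^ a) 1).gaussBound (c := 1 / 64) (by norm_num)
  exact this.mono fun p => by simp [polyFun]

include h0 in
theorem integral_moment (a b : ℕ) : ∫ p, (p.1 ^ 2 / 4) ^ a * p.2 ^ b * f p ∂mu = 0 := by
  rw [← h0 (Polynomial.X ^ a) ((2 * Polynomial.X) ^ b)]
  simp [polyFun, mul_div_cancel₀]

include hf h0 in
theorem integral_pow_mul_cexp_snd (a : ℕ) (η : ℝ) :
    ∫ p, (((p.1 ^ 2 / 4) ^ a * f p : ℝ) : ℂ) * Complex.exp ((η * p.2 : ℝ) * Complex.I) ∂mu = 0 := by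
  refine integral_mul_cexp_eq_zero ?_ ?_ ?_ fun j => ?_
  · exact Complex.continuous_ofReal.comp_aestronglyMeasurable
      ((by fun_prop : Continuous fun p : ℝ × ℝ =>
        (p.1 ^ 2 / 4) ^ a).aestronglyMeasurable.mul hf.1)
  · exact (by fun_prop : Continuous fun p : ℝ × ℝ =>
      ((η * p.2 : ℝ) : ℂ) * Complex.I).aestronglyMeasurable
  · have h1 := (gaussBound_pow a).mul (gaussBound_exp_abs η (c := 1 / 64) (by norm_num))
    have h2 := (integrable_mul_norm_of_gaussBound hf (by norm_num) (by fun_prop) h1).norm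
    refine h2.congr (.of_forall fun p => ?_)
    simp only [norm_mul, Complex.norm_real, Complex.norm_I, Real.norm_eq_abs, Real.abs_exp, mul_one]
    ring
  · have h1 : ∀ p : ℝ × ℝ, (((p.1 ^ 2 / 4) ^ a * f p : ℝ) : ℂ) * ((η * p.2 : ℝ) * Complex.I) ^ j =
        (η * Complex.I) ^ j * (((p.1 ^ 2 / 4) ^ a * p.2 ^ j * f p : ℝ) : ℂ) := fun p => by
      push_cast
      ring
    simp only [h1]
    rw [integral_const_mul, integral_complex_ofReal, integral_moment h0]
    simp

include hf h0 in
-- Unlike `exp (|η| |z|)`, the majorant `exp (|ξ| r²/4)` is square integrable only for small `|ξ|`,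
-- so the series handles only short steps. Phases already gained have modulus 1 and do not affect
-- domination, so `m` steps reach the frequency `m ξ`. Each step needs all powers `a`, because the
-- series raises the power.
theorem integral_pow_mul_cexp (η ξ : ℝ) (hξ : |ξ| ≤ 1 / 4) (m a : ℕ) :
    ∫ p, (((p.1 ^ 2 / 4) ^ a * f p : ℝ) : ℂ) * Complex.exp ((η * p.2 : ℝ) * Complex.I) *
      Complex.exp ((m * ξ * (p.1 ^ 2 / 4) : ℝ) * Complex.I) ∂mu = 0 := by
  induction m generalizing a with
  | zero => simpa using integral_pow_mul_cexp_snd hf h0 a η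
  | succ m ih =>
    have h1 : ∀ p : ℝ × ℝ, Complex.exp (((m + 1 : ℕ) * ξ * (p.1 ^ 2 / 4) : ℝ) * Complex.I) =
        Complex.exp ((m * ξ * (p.1 ^ 2 / 4) : ℝ) * Complex.I) *
          Complex.exp ((ξ * (p.1 ^ 2 / 4) : ℝ) * Complex.I) := fun p => by
      rw [← Complex.exp_add]
      push_cast
      ring_nf
    simp only [h1, ← mul_assoc]
    refine integral_mul_cexp_eq_zero ?_ ?_ ?_ fun j => ?_
    · refine AEStronglyMeasurable.mul (AEStronglyMeasurable.mul ?_ ?_) ?_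
      · exact Complex.continuous_ofReal.comp_aestronglyMeasurable
          ((by fun_prop : Continuous fun p : ℝ × ℝ =>
            (p.1 ^ 2 / 4) ^ a).aestronglyMeasurable.mul hf.1)
      · exact (by fun_prop : Continuous fun p : ℝ × ℝ =>
          Complex.exp ((η * p.2 : ℝ) * Complex.I)).aestronglyMeasurable
      · exact (by fun_prop : Continuous fun p : ℝ × ℝ =>
          Complex.exp ((m * ξ * (p.1 ^ 2 / 4) : ℝ) * Complex.I)).aestronglyMeasurable
    · exact (by fun_prop : Continuous fun p : ℝ × ℝ =>
        ((ξ * (p.1 ^ 2 / 4) : ℝ) : ℂ) * Complex.I).aestronglyMeasurable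
    · have h2 : GaussBound (1 / 16) fun p : ℝ × ℝ => Real.exp (|ξ| * (p.1 ^ 2 / 4)) := by
        refine ⟨1, fun p => ?_⟩
        rw [one_mul, Real.norm_of_nonneg (by positivity), Real.exp_le_exp]
        nlinarith [mul_le_mul_of_nonneg_right hξ (by positivity : 0 ≤ p.1 ^ 2 / 4), sq_nonneg p.2]
      have h3 := (integrable_mul_norm_of_gaussBound hf (by norm_num) (by fun_prop)
        ((gaussBound_pow a).mul h2)).norm
      refine h3.congr (.of_forall fun p => ?_)
      simp only [norm_mul, Complex.norm_real, Complex.norm_I, Real.norm_eq_abs, Real.abs_exp,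
        mul_one, Complex.norm_exp_ofReal_mul_I,
        abs_of_nonneg (by positivity : 0 ≤ p.1 ^ 2 / 4)]
      ring
    · have h2 : ∀ p : ℝ × ℝ, (((p.1 ^ 2 / 4) ^ a * f p : ℝ) : ℂ) *
          Complex.exp ((η * p.2 : ℝ) * Complex.I) *
          Complex.exp ((m * ξ * (p.1 ^ 2 / 4) : ℝ) * Complex.I) *
          ((ξ * (p.1 ^ 2 / 4) : ℝ) * Complex.I) ^ j =
          (ξ * Complex.I) ^ j * ((((p.1 ^ 2 / 4) ^ (a + j) * f p : ℝ) : ℂ) *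
          Complex.exp ((η * p.2 : ℝ) * Complex.I) *
          Complex.exp ((m * ξ * (p.1 ^ 2 / 4) : ℝ) * Complex.I)) := fun p => by
        push_cast
        ring
      simp only [h2]
      rw [integral_const_mul, ih, mul_zero]

include hf h0 in
theorem integral_mul_cexp_linear (t η : ℝ) :
    ∫ p, (f p : ℂ) * Complex.exp ((t * (p.1 ^ 2 / 4) + η * p.2 : ℝ) * Complex.I) ∂mu = 0 := by
  -- Divides the frequency `t` into `m` steps of size at most 1/4.
  obtain ⟨m, hm⟩ := exists_nat_gt (4 * |t|)
  have hm0 : (0 : ℝ) < m := lt_of_le_of_lt (by positivity) hm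
  have h := integral_pow_mul_cexp hf h0 η (t / m) (by
    rw [abs_div, abs_of_pos hm0, div_le_iff₀ hm0]; linarith) m 0
  rw [← h]
  refine integral_congr_ae (.of_forall fun p => ?_)
  dsimp only
  rw [mul_assoc, ← Complex.exp_add, mul_div_cancel₀ _ hm0.ne']
  push_cast
  ring_nf

include hf h0 in
theorem ae_eq_zero_of_integral_polyFun_eq_zero : f =ᵐ[mu] 0 := by
  have hfi : Integrable f mu := hf.integrable (by norm_num)
  have hm : AEMeasurable f mu := hf.1.aemeasurable
  have hmn : AEMeasurable (fun p => -f p) mu := hm.neg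
  have hfn : Integrable (fun p => -f p) mu := hfi.neg
  have hfin : ∀ g : ℝ × ℝ → ℝ, Integrable g mu → ∫⁻ p, ENNReal.ofReal (g p) ∂mu ≠ ⊤ :=
    -- The positive and negative parts of `f dμ` are finite measures. Their images under `T` have
    -- equal Fourier transforms, hence agree, and `S` inverts `T` on the half-plane.
    fun g hg => (hg.lintegral_lt_top).ne
  set νp := mu.withDensity fun p => ENNReal.ofReal (f p) with hνp
  set νn := mu.withDensity fun p => ENNReal.ofReal (-f p) with hνn
  have : IsFiniteMeasure νp := isFiniteMeasure_withDensity (hfin _ hfi)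
  have : IsFiniteMeasure νn := isFiniteMeasure_withDensity (hfin _ hfn)
  let T : ℝ × ℝ → ℝ × ℝ := fun p => (p.1 ^ 2 / 4, p.2)
  let S : ℝ × ℝ → ℝ × ℝ := fun p => (√(4 * p.1), p.2)
  have hT : Measurable T := by fun_prop
  have hS : Measurable S := by fun_prop
  have hST : ∀ ν : Measure (ℝ × ℝ), ν ≪ mu → (ν.map T).map S = ν := fun ν hν => by
    rw [Measure.map_map hS hT]
    conv_rhs => rw [← Measure.map_id (μ := ν)]
    refine Measure.map_congr (hν.ae_le ?_)
    filter_upwards [ae_mem_halfPlane] with p hp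
    have hp0 : 0 < p.1 := hp
    simp only [Function.comp_apply, T, S, id_eq, mul_div_cancel₀ (p.1 ^ 2) (four_ne_zero)]
    rw [Real.sqrt_sq hp0.le]
  have hcf : νp.map T = νn.map T := by
    refine Measure.ext_of_charFunDual (funext fun L => ?_)
    have hL : ∀ p : ℝ × ℝ, L (T p) = L (1, 0) * (p.1 ^ 2 / 4) + L (0, 1) * p.2 := fun p => by
      have : T p = (p.1 ^ 2 / 4) • ((1, 0) : ℝ × ℝ) + p.2 • ((0, 1) : ℝ × ℝ) := by simp [T]
      rw [this, map_add, map_smul, map_smul, smul_eq_mul, smul_eq_mul]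
      ring
    have hexp : AEStronglyMeasurable (fun p => Complex.exp (L (T p) * Complex.I)) mu := by
      refine Continuous.aestronglyMeasurable ?_
      fun_prop
    have hi : ∀ g : ℝ × ℝ → ℝ, Integrable g mu →
        Integrable (fun p => (ENNReal.ofReal (g p)).toReal • Complex.exp (L (T p) * Complex.I)) mu :=
      fun g hg => by
        refine hg.norm.mono' ?_ (.of_forall fun p => ?_)
        · exact (hg.1.aemeasurable.ennreal_ofReal.ennreal_toReal).aestronglyMeasurable.smul hexp
        · rw [norm_smul, Complex.norm_exp_ofReal_mul_I, mul_one, ENNReal.toReal_ofReal',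
            Real.norm_eq_abs, Real.norm_eq_abs, abs_of_nonneg (le_max_right _ _)]
          exact max_le (le_abs_self _) (abs_nonneg _)
    have hexpm : Measurable fun x : ℝ × ℝ => Complex.exp (L x * Complex.I) := by fun_prop
    rw [charFunDual_apply, charFunDual_apply,
      integral_map hT.aemeasurable hexpm.aestronglyMeasurable,
      integral_map hT.aemeasurable hexpm.aestronglyMeasurable, hνp, hνn,
      integral_withDensity_eq_integral_toReal_smul₀ hm.ennreal_ofReal (by simp),
      integral_withDensity_eq_integral_toReal_smul₀ hmn.ennreal_ofReal (by simp),
      ← sub_eq_zero, ← integral_sub (hi _ hfi) (hi _ hfn),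
      ← integral_mul_cexp_linear hf h0 (L (1, 0)) (L (0, 1))]
    refine integral_congr_ae (.of_forall fun p => ?_)
    simp only [hL]
    rw [← sub_smul, ENNReal.toReal_ofReal', ENNReal.toReal_ofReal', Complex.real_smul]
    congr 2
    rcases le_total 0 (f p) with h | h
    · rw [max_eq_left h, max_eq_right (by linarith), sub_zero]
    · rw [max_eq_right h, max_eq_left (by linarith)]; ring
  have hν : νp = νn := by
    rw [← hST νp (withDensity_absolutelyContinuous _ _), hcf,
      hST νn (withDensity_absolutelyContinuous _ _)]
  rw [hνp, hνn, withDensity_eq_iff hm.ennreal_ofReal hmn.ennreal_ofReal (hfin _ hfi)] at hν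
  filter_upwards [hν] with p hp
  have h1 := congrArg ENNReal.toReal hp
  simp only [ENNReal.toReal_ofReal'] at h1
  rcases le_total 0 (f p) with h | h
  · rw [max_eq_left h, max_eq_right (by linarith)] at h1
    exact h1
  · rw [max_eq_right h, max_eq_left (by linarith)] at h1
    simp only [Pi.zero_apply]
    linarith

end Completeness

variable {𝕜 : Type*} [RCLike 𝕜]

theorem polyFun_integral_bilin (f : Lp 𝕜 2 mu) :
    ∃ B : Polynomial ℝ →ₗ[ℝ] Polynomial ℝ →ₗ[ℝ] 𝕜,
      ∀ P Q, B P Q = ∫ p, polyFun P Q p • f p ∂mu := by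
  have hi := fun P Q => integrable_smul_of_memLp (memLp_polyFun P Q) f
  refine ⟨LinearMap.mk₂ ℝ (fun P Q => ∫ p, polyFun P Q p • f p ∂mu) (fun P P' Q => ?_)
    (fun c P Q => ?_) (fun P Q Q' => ?_) (fun c P Q => ?_), fun P Q => rfl⟩
  · rw [← integral_add (hi _ _) (hi _ _)]
    simp only [polyFun, Polynomial.eval_add, add_mul, add_smul]
  · rw [← integral_smul]
    simp only [polyFun, Polynomial.eval_smul, smul_eq_mul, mul_assoc, mul_smul]
  · rw [← integral_add (hi _ _) (hi _ _)]
    simp only [polyFun, Polynomial.eval_add, mul_add, add_smul]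
  · rw [← integral_smul]
    simp only [polyFun, Polynomial.eval_smul, smul_eq_mul, mul_left_comm, mul_smul]

theorem span_laguerre_one : Submodule.span ℝ (range (laguerre 1)) = ⊤ :=
  Polynomial.Sequence.span (S := ⟨laguerre 1, degree_laguerre_one⟩) fun i =>
    (Polynomial.leadingCoeff_ne_zero.mpr (Polynomial.Sequence.ne_zero _ i)).isUnit

theorem span_hermite : Submodule.span ℝ (range hermite) = ⊤ :=
  Polynomial.Sequence.span (S := ⟨hermite, degree_hermite⟩) fun i =>
    (Polynomial.leadingCoeff_ne_zero.mpr (Polynomial.Sequence.ne_zero _ i)).isUnit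

/-- The Laguerre and the Hermite polynomials each span all polynomials, so by bilinearity every
moment vanishes. The test polynomials are real, so real and imaginary parts separate. -/
theorem eq_zero_of_inner_eigenfun_eq_zero (f : Lp 𝕜 2 mu)
    (hf : ∀ ℓ n, inner 𝕜 (toL2 𝕜 _ (memLp_eigenfun ℓ n)) f = 0) : f = 0 := by
  obtain ⟨B, hB⟩ := polyFun_integral_bilin f
  have hB0 : B = 0 := by
    refine LinearMap.ext_on span_laguerre_one ?_
    rintro _ ⟨ℓ, rfl⟩
    refine LinearMap.ext_on span_hermite ?_
    rintro _ ⟨n, rfl⟩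
    rw [hB]
    have := hf ℓ n
    rw [inner_toL2] at this
    exact this
  have h0 : ∀ P Q, ∫ p, polyFun P Q p • f p ∂mu = 0 := fun P Q => by rw [← hB, hB0]; rfl
  have hi := fun P Q => integrable_smul_of_memLp (memLp_polyFun P Q) f
  have hre : ∀ P Q, ∫ p, polyFun P Q p * RCLike.re (f p) ∂mu = 0 := fun P Q => by
    have := (RCLike.reCLM (K := 𝕜)).integral_comp_comm (hi P Q)
    rw [h0, map_zero] at this
    simpa [RCLike.smul_re] using this
  have him : ∀ P Q, ∫ p, polyFun P Q p * RCLike.im (f p) ∂mu = 0 := fun P Q => by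
    have := (RCLike.imCLM (K := 𝕜)).integral_comp_comm (hi P Q)
    rw [h0, map_zero] at this
    simpa [RCLike.smul_im] using this
  refine Lp.ext ?_
  filter_upwards [ae_eq_zero_of_integral_polyFun_eq_zero (Lp.memLp f).re hre,
    ae_eq_zero_of_integral_polyFun_eq_zero (Lp.memLp f).im him, Lp.coeFn_zero 𝕜 2 mu]
    with p h1 h2 h3
  rw [h3]
  exact RCLike.ext (by simpa using h1) (by simpa using h2)

/-! ### The orthonormal basis of eigenfunctions -/

theorem exists_pos_eval_ne_zero {P : Polynomial ℝ} (hP : P ≠ 0) : ∃ s : ℝ, 0 < s ∧ P.eval s ≠ 0 := by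
  by_contra! h
  exact hP (Polynomial.eq_zero_of_infinite_isRoot P ((Ioi_infinite (0 : ℝ)).mono h))

theorem integral_eigenfun_sq_ne_zero (ℓ n : ℕ) :
    ∫ p, eigenfun ℓ n p * eigenfun ℓ n p ∂mu ≠ 0 := by
  intro h
  have hi : Integrable (fun p => eigenfun ℓ n p * eigenfun ℓ n p) mu :=
    (memLp_eigenfun ℓ n).integrable_mul (memLp_eigenfun ℓ n)
  rw [integral_eq_zero_iff_of_nonneg (fun p => mul_self_nonneg _) hi] at h
  -- Positivity of the density transfers vanishing almost everywhere to Lebesgue measure; continuity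
  -- then gives vanishing on the whole open half-plane.
  have hac : volume.restrict halfPlane ≪ mu := by
    refine withDensity_absolutelyContinuous' continuous_density.measurable.ennreal_ofReal.aemeasurable
      ((ae_restrict_iff' isOpen_halfPlane.measurableSet).mpr (.of_forall fun p hp => ?_))
    have : 0 < p.1 := hp
    have hd : 0 < density p := by unfold density; positivity
    exact (ENNReal.ofReal_pos.mpr hd).ne'
  have h1 : eigenfun ℓ n =ᵐ[volume.restrict halfPlane] 0 := by
    filter_upwards [hac.ae_le h] with p hp
    exact mul_self_eq_zero.mp hp
  have h2 := Measure.eqOn_open_of_ae_eq h1 isOpen_halfPlane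
    (contDiff_eigenfun ℓ n).continuous.continuousOn continuousOn_const
  obtain ⟨s, hs, hs'⟩ := exists_pos_eval_ne_zero
    (Polynomial.Sequence.ne_zero ⟨laguerre 1, degree_laguerre_one⟩ ℓ)
  obtain ⟨w, -, hw⟩ := exists_pos_eval_ne_zero
    (Polynomial.Sequence.ne_zero ⟨hermite, degree_hermite⟩ n)
  have h3 := h2 (show (√(4 * s), 2 * w) ∈ halfPlane from Real.sqrt_pos.mpr (by positivity))
  simp only [eigenfun, Pi.zero_apply, Real.sq_sqrt (by positivity : 0 ≤ 4 * s),
    mul_div_cancel_left₀ _ (four_ne_zero' ℝ), mul_div_cancel_left₀ _ (two_ne_zero' ℝ)] at h3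
  exact (mul_ne_zero hs' hw) h3

theorem integral_eigenfun_mul_of_eigenval_ne {ℓ n ℓ' n' : ℕ} (h : eigenval ℓ n ≠ eigenval ℓ' n') :
    ∫ p, eigenfun ℓ n p * eigenfun ℓ' n' p ∂mu = 0 := by
  have h1 := inner_eigenfun_of_mem_opGraph (eigenfun_mem_opGraph (𝕜 := ℝ) ℓ' n') ℓ n
  simp only [inner_smul_right, inner_toL2_toL2, RCLike.ofReal_real_eq_id, id_eq] at h1
  by_contra hne
  exact h (mul_right_cancel₀ hne h1).symm

theorem exists_integral_eigenfun_mul : ∃ I J : ℕ → ℕ → ℝ, ∀ ℓ n ℓ' n',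
    ∫ p, eigenfun ℓ n p * eigenfun ℓ' n' p ∂mu = I ℓ ℓ' * J n n' := by
  refine ⟨fun ℓ ℓ' => 1 / (16 * √Real.pi) * ∫ r in Ioi (0 : ℝ), r ^ 3 * Real.exp (-r ^ 2 / 4) *
      ((laguerre 1 ℓ).eval (r ^ 2 / 4) * (laguerre 1 ℓ').eval (r ^ 2 / 4)),
    fun n n' => ∫ z : ℝ, Real.exp (-z ^ 2 / 4) *
      ((hermite n).eval (z / 2) * (hermite n').eval (z / 2)), fun ℓ n ℓ' n' => ?_⟩
  rw [mul_assoc, ← integral_mu_prod]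
  refine integral_congr_ae (.of_forall fun p => ?_)
  simp only [eigenfun]
  ring

/-- Distinct pairs can share an eigenvalue, so symmetry alone is not enough. The integral factors
into an `r` part and a `z` part; setting the other indices to 0 makes the eigenvalues distinct and
shows that the relevant factor vanishes. -/
theorem integral_eigenfun_mul_eq_zero {ℓ n ℓ' n' : ℕ} (h : (ℓ, n) ≠ (ℓ', n')) :
    ∫ p, eigenfun ℓ n p * eigenfun ℓ' n' p ∂mu = 0 := by
  obtain ⟨I, J, hIJ⟩ := exists_integral_eigenfun_mul
  have h0 := integral_eigenfun_sq_ne_zero 0 0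
  rw [hIJ] at h0 ⊢
  by_cases hl : ℓ = ℓ'
  · have hn : n ≠ n' := fun hn => h (by rw [hl, hn])
    have := integral_eigenfun_mul_of_eigenval_ne (ℓ := 0) (ℓ' := 0) (n := n) (n' := n')
      (by simpa [eigenval] using hn)
    rw [hIJ] at this
    rw [(mul_eq_zero.mp this).resolve_left (left_ne_zero_of_mul h0), mul_zero]
  · have := integral_eigenfun_mul_of_eigenval_ne (ℓ := ℓ) (ℓ' := ℓ') (n := 0) (n' := 0)
      (by simpa [eigenval] using hl)
    rw [hIJ] at this
    rw [(mul_eq_zero.mp this).resolve_right (right_ne_zero_of_mul h0), zero_mul]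

section Basis

variable (𝕜 : Type*) [RCLike 𝕜]

theorem toL2_eigenfun_ne_zero (ℓ n : ℕ) : toL2 𝕜 _ (memLp_eigenfun ℓ n) ≠ 0 := fun h => by
  have := inner_toL2_toL2 (𝕜 := 𝕜) (memLp_eigenfun ℓ n) (memLp_eigenfun ℓ n)
  rw [h, inner_zero_left, eq_comm, RCLike.ofReal_eq_zero] at this
  exact integral_eigenfun_sq_ne_zero ℓ n this

/-- The normalization constants. -/
noncomputable def normConst (i : ℕ × ℕ) : ℝ := ‖toL2 𝕜 _ (memLp_eigenfun i.1 i.2)‖⁻¹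

theorem normConst_pos (i : ℕ × ℕ) : 0 < normConst 𝕜 i :=
  inv_pos.mpr (norm_pos_iff.mpr (toL2_eigenfun_ne_zero 𝕜 i.1 i.2))

/-- The normalized eigenfunctions. -/
noncomputable def eigenvec (i : ℕ × ℕ) : Lp 𝕜 2 mu :=
  (normConst 𝕜 i : 𝕜) • toL2 𝕜 _ (memLp_eigenfun i.1 i.2)

theorem orthonormal_eigenvec : Orthonormal 𝕜 (eigenvec 𝕜) := by
  refine ⟨fun i => ?_, fun i j hij => ?_⟩
  · rw [eigenvec, norm_smul, RCLike.norm_ofReal, abs_of_pos (normConst_pos 𝕜 i), normConst]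
    exact inv_mul_cancel₀ (norm_ne_zero_iff.mpr (toL2_eigenfun_ne_zero 𝕜 i.1 i.2))
  · change inner 𝕜 (eigenvec 𝕜 i) (eigenvec 𝕜 j) = 0
    rw [eigenvec, eigenvec, inner_smul_left, inner_smul_right, inner_toL2_toL2,
      integral_eigenfun_mul_eq_zero hij]
    simp

theorem orthogonal_span_eigenvec : (Submodule.span 𝕜 (range (eigenvec 𝕜)))ᗮ = ⊥ := by
  refine (Submodule.eq_bot_iff _).mpr fun f hf => eq_zero_of_inner_eigenfun_eq_zero f fun ℓ n => ?_
  have h := (Submodule.mem_orthogonal _ f).mp hf _ (Submodule.subset_span ⟨(ℓ, n), rfl⟩)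
  rw [eigenvec, inner_smul_left, RCLike.conj_ofReal, mul_eq_zero, RCLike.ofReal_eq_zero] at h
  exact h.resolve_left (normConst_pos 𝕜 (ℓ, n)).ne'

/-- The Hilbert basis of eigenfunctions. -/
noncomputable def eigenbasis : HilbertBasis (ℕ × ℕ) 𝕜 (Lp 𝕜 2 mu) :=
  HilbertBasis.mkOfOrthogonalEqBot (orthonormal_eigenvec 𝕜) (orthogonal_span_eigenvec 𝕜)

theorem eigenbasis_apply (i : ℕ × ℕ) : eigenbasis 𝕜 i =
    (normConst 𝕜 i : 𝕜) • toL2 𝕜 _ (memLp_eigenfun i.1 i.2) := by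
  rw [eigenbasis, HilbertBasis.coe_mkOfOrthogonalEqBot, eigenvec]

/-- The forward direction tests with eigenfunctions; the converse expands `diffExpr φ` and `φ` in
the basis and compares the two Parseval sums term by term. -/
theorem isDiagonal_op : IsDiagonal (op 𝕜) (eigenbasis 𝕜) fun i => eigenval i.1 i.2 := by
  intro f g
  rw [op_graph]
  constructor
  · intro h i
    rw [eigenbasis_apply, inner_smul_left, inner_smul_left, inner_eigenfun_of_mem_opGraph h]
    ring
  · intro h
    rw [mem_opGraph_iff]
    intro φ hφ
    have h1 := (eigenbasis 𝕜).hasSum_inner_mul_inner (toL2 𝕜 _ hφ.memLp_diffExpr) f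
    have h2 := (eigenbasis 𝕜).hasSum_inner_mul_inner (toL2 𝕜 _ hφ.memLp) g
    refine h1.unique ?_
    convert h2 using 2 with i
    have h3 := (mem_opGraph_iff _).mp (eigenfun_mem_opGraph (𝕜 := 𝕜) i.1 i.2) φ hφ
    rw [inner_smul_right] at h3
    rw [h i, eigenbasis_apply, inner_smul_right, inner_smul_right, h3]
    ring

/-! ### Counting eigenvalues -/

theorem finite_eigenval_le (R : ℝ) : {i : ℕ × ℕ | |eigenval i.1 i.2| ≤ R}.Finite := by
  obtain ⟨N, hN⟩ := exists_nat_ge R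
  refine ((finite_Iic N).prod (finite_Iic (2 * N))).subset fun i hi => ?_
  have hi : |eigenval i.1 i.2| ≤ R := hi
  have h := (le_abs_self _).trans (hi.trans hN)
  unfold eigenval at h
  have h1 : (0 : ℝ) ≤ i.1 := Nat.cast_nonneg _
  have h2 : (0 : ℝ) ≤ i.2 := Nat.cast_nonneg _
  refine ⟨?_, ?_⟩
  · exact_mod_cast (by linarith : (i.1 : ℝ) ≤ N)
  · exact_mod_cast (by linarith : (i.2 : ℝ) ≤ 2 * N)

/-- The condition is `2ℓ + n = 2m + d`; since `d < 2`, the index `ℓ` ranges freely over `0, …, m`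
and determines `n`. -/
theorem ncard_eigenval_eq (m d : ℕ) (hd : d < 2) :
    {i : ℕ × ℕ | ((eigenval i.1 i.2 : ℝ) : 𝕜) = (((2 * m + d : ℝ) / 2 : ℝ) : 𝕜)}.ncard = m + 1 := by
  have e : {i : ℕ × ℕ | ((eigenval i.1 i.2 : ℝ) : 𝕜) = (((2 * m + d : ℝ) / 2 : ℝ) : 𝕜)} =
      (fun k => (k, 2 * (m - k) + d)) '' (Finset.range (m + 1) : Set ℕ) := by
    ext ⟨ℓ, n⟩
    simp only [mem_ofPred_eq, RCLike.ofReal_inj, Finset.coe_range, mem_image, mem_Iio,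
      Prod.mk.injEq, eigenval]
    have : ((ℓ : ℝ) + n / 2 = (2 * m + d) / 2) ↔ 2 * ℓ + n = 2 * m + d := by
      rw [← Nat.cast_inj (R := ℝ)]
      push_cast
      constructor <;> intro h <;> linarith
    rw [this]
    constructor
    · intro h
      exact ⟨ℓ, by omega, rfl, by omega⟩
    · rintro ⟨k, hk, rfl, rfl⟩
      omega
  rw [e, ncard_image_of_injective _ fun a b h => (Prod.mk.inj h).1, ncard_coe_finset,
    Finset.card_range]

end Basis

end VortexSpectrum

/-! ### The spectral theorem for the operator -/

theorem mainTheorem2 (𝕜 : Type*) [RCLike 𝕜] :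
    IsSelfAdjoint (VortexSpectrum.op 𝕜) ∧
    VortexSpectrum.HasPurelyDiscreteSpectrum (VortexSpectrum.op 𝕜) ∧
    VortexSpectrum.spectrum (VortexSpectrum.op 𝕜) =
      {ζ : 𝕜 | ∃ ℓ n : ℕ, ζ = ((VortexSpectrum.eigenval ℓ n : ℝ) : 𝕜)} ∧
    {ζ : 𝕜 | VortexSpectrum.eigenspace (VortexSpectrum.op 𝕜) ζ ≠ ⊥} =
      {ζ : 𝕜 | ∃ ℓ n : ℕ, ζ = ((VortexSpectrum.eigenval ℓ n : ℝ) : 𝕜)} ∧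
    (∀ (ℓ n : ℕ), ∀ p ∈ VortexSpectrum.halfPlane,
      VortexSpectrum.diffExpr (VortexSpectrum.eigenfun ℓ n) p =
        VortexSpectrum.eigenval ℓ n * VortexSpectrum.eigenfun ℓ n p) ∧
    (∃ c : ℕ → ℕ → ℝ, (∀ ℓ n, 0 < c ℓ n) ∧
      ∃ ψ : HilbertBasis (ℕ × ℕ) 𝕜 (Lp 𝕜 2 VortexSpectrum.mu),
        (∀ ℓ n : ℕ,
          (ψ (ℓ, n) : ℝ × ℝ → 𝕜) =ᵐ[VortexSpectrum.mu]
            (fun p => ((c ℓ n * VortexSpectrum.eigenfun ℓ n p : ℝ) : 𝕜)) ∧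
          ψ (ℓ, n) ∈ VortexSpectrum.eigenspace (VortexSpectrum.op 𝕜)
            ((VortexSpectrum.eigenval ℓ n : ℝ) : 𝕜)) ∧
        ∀ ζ : 𝕜, VortexSpectrum.eigenspace (VortexSpectrum.op 𝕜) ζ =
          Submodule.span 𝕜
            {v | ∃ ℓ n : ℕ, ((VortexSpectrum.eigenval ℓ n : ℝ) : 𝕜) = ζ ∧ v = ψ (ℓ, n)}) ∧
    (∀ m : ℕ,
      Module.finrank 𝕜 (VortexSpectrum.eigenspace (VortexSpectrum.op 𝕜)
        (((2 * m : ℝ) / 2 : ℝ) : 𝕜)) = m + 1 ∧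
      Module.finrank 𝕜 (VortexSpectrum.eigenspace (VortexSpectrum.op 𝕜)
        (((2 * m + 1 : ℝ) / 2 : ℝ) : 𝕜)) = m + 1) := by
  have hA := VortexSpectrum.isDiagonal_op 𝕜
  have hfin := VortexSpectrum.finite_eigenval_le
  have hset : {ζ : 𝕜 | ∃ i : ℕ × ℕ, ((VortexSpectrum.eigenval i.1 i.2 : ℝ) : 𝕜) = ζ} =
      {ζ : 𝕜 | ∃ ℓ n : ℕ, ζ = ((VortexSpectrum.eigenval ℓ n : ℝ) : 𝕜)} := by
    ext ζ
    simp only [mem_ofPred_eq, Prod.exists, eq_comm]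
  refine ⟨hA.isSelfAdjoint, hA.hasPurelyDiscreteSpectrum hfin, (hA.spectrum_eq hfin).trans hset,
    ?_, VortexSpectrum.diffExpr_eigenfun, ⟨fun ℓ n => VortexSpectrum.normConst 𝕜 (ℓ, n),
      fun ℓ n => VortexSpectrum.normConst_pos 𝕜 (ℓ, n), VortexSpectrum.eigenbasis 𝕜,
      fun ℓ n => ⟨?_, hA.basis_mem_eigenspace (ℓ, n)⟩, fun ζ => ?_⟩, fun m => ⟨?_, ?_⟩⟩
  · rw [← hset]
    ext ζ
    exact hA.eigenspace_ne_bot_iff ζ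
  · rw [VortexSpectrum.eigenbasis_apply]
    filter_upwards [Lp.coeFn_smul (VortexSpectrum.normConst 𝕜 (ℓ, n) : 𝕜)
      (VortexSpectrum.toL2 𝕜 _ (VortexSpectrum.memLp_eigenfun ℓ n)),
      VortexSpectrum.coeFn_toL2 (𝕜 := 𝕜) (VortexSpectrum.memLp_eigenfun ℓ n)] with p h1 h2
    rw [h1, Pi.smul_apply, h2, smul_eq_mul, RCLike.ofReal_mul]
  · rw [hA.eigenspace_eq_span hfin]
    congr 1
    ext v
    simp only [mem_image, mem_ofPred_eq, Prod.exists, eq_comm]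
  · rw [hA.finrank_eigenspace hfin]
    simpa using VortexSpectrum.ncard_eigenval_eq 𝕜 m 0 (by norm_num)
  · rw [hA.finrank_eigenspace hfin]
    simpa using VortexSpectrum.ncard_eigenval_eq 𝕜 m 1 (by norm_num)
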